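/- Let $E$ be a finite-dimensional real normed space, let $D\subset E$ be a bounded open convex set, and let $b,o\in D$. For distinct $x,y\in D$, let $w,z$ be the points of the boundary of $D$ such that $w,x,y,z$ lie in this order on a line, and let $$d(x,y)=\log\left(\frac{|zx|}{|zy|}\,\frac{|wy|}{|wx|}\right),\qquad d(x,x)=0,$$ be the Hilbert distance on $D$. For $z\in D$ put $\psi_z(x)=d(x,z)-d(b,z)$. The horofunctions of the Hilbert geometry are the elements of $\overline{\{\psi_z : z\in D\}}\setminus\{\psi_z : z\in D\}$, the closure being taken in the space of continuous real functions on $(D,d)$ with the topology of uniform convergence on $d$-bounded sets. An almost-geodesic is a map $\gamma\colon T\to D$, where $T\subset[0,\infty)$ contains $0$ and does not contain $\sup T\in[0,\infty]$, such that for every $\varepsilon>0$ one has $|d(\gamma(0),\gamma(s))+d(\gamma(s),\gamma(t))-t|<\varepsilon$ for all sufficiently large $s\le t$ in $T$. A horofunction $f$ is a Busemann point if there is an almost-geodesic $\gamma$ such that $\psi_{\gamma(t)}\to f$, in the same topology, as $t\to\sup T$. Let $D^\circ=\{u\in E^* : u(x-o)\le 1 \text{ for all } x\in D\}$ be the polar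 of $D$ with respect to the origin $o$. A convex subset $F\subset D^\circ$ is an extreme set of $D^\circ$ if, whenever a relative interior point of a line segment in $D^\circ$ lies in $F$, both endpoints of the segment lie in $F$. (Extreme sets of $D^\circ$ are closed.) A sequence $(C_n)$ of closed subsets of $E^*$ converges to a closed set $C$ in the Painlevé–Kuratowski topology if $$\bigcap_{n}\overline{\bigcup_{i>n}C_i}=C=\bigcap_{(n_i)}\overline{\bigcup_{i}C_{n_i}},$$ where the last intersection is over all strictly increasing sequences $(n_i)$ in $\mathbb N$; a family of closed sets is closed in this topology if it contains every limit of a convergent sequence of its members. Then all horofunctions of the Hilbert geometry on $D$ are Busemann points if and only if the set of extreme sets of $D^\circ$ is closed in the Painlevé–Kuratowski topology. -/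

import Mathlib

open Set Filter Topology TopologicalSpace

/-! ### The horofunction boundary of a (possibly non-reversible) metric `d` on `X` -/

section Horofunctions

variable {X : Type*}

/-- The symmetrised distance `d(x, y) + d(y, x)`. -/
def symDist (d : X → X → ℝ) (x y : X) : ℝ := d x y + d y x

/-- The sets that are bounded for the symmetrised distance. -/
def symBoundedSets (d : X → X → ℝ) : Set (Set X) :=
  {B | ∃ r : ℝ, ∀ x ∈ B, ∀ y ∈ B, symDist d x y ≤ r}

/-- Continuity of a real function for the topology of the symmetrised distance. -/
def SymContinuous (d : X → X → ℝ) (f : X → ℝ) : Prop :=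
  ∀ x, ∀ ε > 0, ∃ δ > 0, ∀ y, symDist d x y < δ → |f y - f x| < ε

/-- The function `ψ_z(x) = d(x, z) - d(b, z)`, where `b` is the base-point. -/
def distFun (d : X → X → ℝ) (b z : X) : X → ℝ := fun x => d x z - d b z

/-- A real function on `X`, regarded as a point of the space of all real functions on `X` with the
topology of uniform convergence on the bounded sets of the symmetrised distance. -/
def asUniformOnBounded (d : X → X → ℝ) (f : X → ℝ) :
    UniformOnFun X ℝ (symBoundedSets d) :=
  UniformOnFun.ofFun (symBoundedSets d) f

/-- The horofunctions of `(X, d)` with base-point `b`: the continuous functions that lie in the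
closure of `{ψ_z | z ∈ X}`, for uniform convergence on bounded sets, but are none of the `ψ_z`. -/
def horofunctions (d : X → X → ℝ) (b : X) : Set (X → ℝ) :=
  {f | SymContinuous d f ∧
    asUniformOnBounded d f ∈ closure (range fun z => asUniformOnBounded d (distFun d b z)) ∧
    f ∉ range (distFun d b)}

/-- `γ : T → X` is an almost-geodesic: `T ⊆ [0, ∞)` contains `0` and does not contain its supremum
(taken in `[0, ∞]`), and for every `ε > 0` one has
`|d(γ(0), γ(s)) + d(γ(s), γ(t)) - t| < ε` for all large enough `s ≤ t` in `T`. -/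
def IsAlmostGeodesic (d : X → X → ℝ) (T : Set ℝ) (γ : T → X) : Prop :=
  T ⊆ Ici 0 ∧ (∀ t ∈ T, ∃ s ∈ T, t < s) ∧
    ∃ h0 : (0 : ℝ) ∈ T, ∀ ε > 0, ∃ t₀ : T, ∀ s t : T, t₀ ≤ s → s ≤ t →
      |d (γ ⟨0, h0⟩) (γ s) + d (γ s) (γ t) - (t : ℝ)| < ε

/-- A Busemann point is a horofunction that is the limit of an almost-geodesic `γ : T → X`,
that is, `ψ_{γ(t)}` converges to it as `t` tends to `sup T` in `T`. -/
def IsBusemannPoint (d : X → X → ℝ) (b : X) (f : X → ℝ) : Prop :=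
  f ∈ horofunctions d b ∧
    ∃ (T : Set ℝ) (γ : T → X), IsAlmostGeodesic d T γ ∧
      Tendsto (fun t : T => asUniformOnBounded d (distFun d b (γ t))) atTop
        (𝓝 (asUniformOnBounded d f))

end Horofunctions

/-! ### The Hilbert geometry and the polar of a convex domain -/

section Hilbert

variable {E : Type*} [NormedAddCommGroup E] [NormedSpace ℝ E]

/-- For distinct points `x, y` of a bounded open convex set `D`, the boundary point `z` of `D` at
which the ray from `x` through `y` leaves `D`. -/
noncomputable def exitPoint (D : Set E) (x y : E) : E :=
  x + sSup {s : ℝ | x + s • (y - x) ∈ D} • (y - x)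

open Classical in
/-- The Hilbert distance `log (|zx| / |zy| * (|wy| / |wx|))`, where `w, x, y, z` lie in this order
on a line and `w, z` are in the boundary of `D`; the distance from a point to itself is `0`. -/
noncomputable def hilbertDist (D : Set E) (x y : D) : ℝ :=
  if x = y then 0
  else
    Real.log
      (‖exitPoint D x y - x‖ / ‖exitPoint D x y - y‖ *
        (‖exitPoint D y x - y‖ / ‖exitPoint D y x - x‖))

/-- The polar of `D`, in the dual space, when the point `o` is taken as the origin. -/
def polarAt (D : Set E) (o : E) : Set (StrongDual ℝ E) :=
  {u | ∀ x ∈ D, u (x - o) ≤ 1}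

end Hilbert

/-! ### The Painlevé–Kuratowski topology and extreme sets -/

section PainleveKuratowski

variable {Y : Type*} [TopologicalSpace Y]

/-- The upper closed limit of a sequence of sets. -/
def upperClosedLimit (C : ℕ → Set Y) : Set Y :=
  ⋂ n : ℕ, closure (⋃ i > n, C i)

/-- The lower closed limit of a sequence of sets. -/
def lowerClosedLimit (C : ℕ → Set Y) : Set Y :=
  ⋂ φ : {φ : ℕ → ℕ // StrictMono φ}, closure (⋃ i : ℕ, C (φ.1 i))

/-- Painlevé–Kuratowski convergence of a sequence of closed sets. -/
def PKTendsto (C : ℕ → Closeds Y) (L : Closeds Y) : Prop :=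
  upperClosedLimit (fun n => (C n : Set Y)) = L ∧ lowerClosedLimit (fun n => (C n : Set Y)) = L

theorem lowerClosedLimit_subset_upperClosedLimit (C : ℕ → Set Y) :
    lowerClosedLimit C ⊆ upperClosedLimit C := by
  intro x hx
  refine mem_iInter.2 fun n => ?_
  have h := mem_iInter.1 hx ⟨fun i => i + (n + 1), fun a b hab => Nat.add_lt_add_right hab _⟩
  refine closure_mono ?_ h
  refine iUnion_subset fun i => ?_
  exact subset_biUnion_of_mem (u := fun i => C i) (show i + (n + 1) > n by omega)

theorem PKTendsto.comp {C : ℕ → Closeds Y} {L : Closeds Y} (h : PKTendsto C L)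
    {φ : ℕ → ℕ} (hφ : StrictMono φ) : PKTendsto (fun n => C (φ n)) L := by
  have h1 : upperClosedLimit (fun n => (C (φ n) : Set Y)) ⊆ L := by
    rw [← h.1]
    refine iInter_mono fun n => closure_mono ?_
    refine iUnion₂_subset fun i hi => ?_
    exact subset_biUnion_of_mem (u := fun i => (C i : Set Y))
      (show φ i > n from lt_of_lt_of_le hi (hφ.id_le i))
  have h2 : (L : Set Y) ⊆ lowerClosedLimit (fun n => (C (φ n) : Set Y)) := by
    rw [← h.2]
    intro x hx
    exact mem_iInter.2 fun χ => mem_iInter.1 hx ⟨φ ∘ χ.1, hφ.comp χ.2⟩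
  have h3 := lowerClosedLimit_subset_upperClosedLimit (fun n => (C (φ n) : Set Y))
  exact ⟨h1.antisymm (h2.trans h3), (h3.trans h1).antisymm h2⟩

/-- The Painlevé–Kuratowski topology on the closed subsets of `Y`: a family of closed sets is closed
if and only if it contains every Painlevé–Kuratowski limit of a sequence of its members. -/
@[reducible] def painleveKuratowskiTopology (Y : Type*) [TopologicalSpace Y] : TopologicalSpace (Closeds Y) :=
  TopologicalSpace.ofClosed
    {𝒮 | ∀ (C : ℕ → Closeds Y) (L : Closeds Y), (∀ n, C n ∈ 𝒮) → PKTendsto C L → L ∈ 𝒮}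
    (fun _ _ hC _ => (hC 0).elim)
    (fun _ hA C L hC hL => mem_sInter.2 fun 𝒮 h𝒮 =>
      hA h𝒮 C L (fun n => mem_sInter.1 (hC n) 𝒮 h𝒮) hL)
    (by
      intro A hA B hB C L hC hL
      by_cases hfreq : ∃ᶠ n in atTop, C n ∈ A
      · obtain ⟨φ, hφ, hφA⟩ := extraction_of_frequently_atTop hfreq
        exact Or.inl (hA _ L hφA (hL.comp hφ))
      · have hev : ∀ᶠ n in atTop, C n ∈ B :=
          (not_frequently.1 hfreq).mono fun n hn => (hC n).resolve_left hn
        obtain ⟨φ, hφ, hφB⟩ := extraction_of_frequently_atTop hev.frequently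
        exact Or.inr (hB _ L hφB (hL.comp hφ)))

end PainleveKuratowski

/-- The (closed, convex) extreme sets of a set `K`. -/
def extremeSets {V : Type*} [AddCommGroup V] [Module ℝ V] [TopologicalSpace V] (K : Set V) :
    Set (Closeds V) :=
  {F | Convex ℝ (F : Set V) ∧ IsExtreme ℝ K (F : Set V)}

/-!
Let `K` be the polar of `D` with respect to `o`. A point `x` of `D` is regarded as the affine
function `gap o x : u ↦ 1 - u (x - o)`; up to positive factors, these are all the affine functions
that are positive on the compact convex set `K`. The Hilbert distance is `F x y + F y x`
(`hilbertDist_eq`), where the Funk distance `F x y = funk o K x y` is the logarithm of the maximum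
over `K` of `gap o x / gap o y`. When `z` tends to a boundary point `ξ` of `D`, the functions
`F z · - F z b` converge to `F ξ · - F ξ b`, so what matters is the limit of `F · z - F b z`. The
latter depends on the behaviour of the affine functions `gap o z`, suitably scaled, at the points of
`K` where they remain bounded.

**From closed faces to Busemann points.** If the family of faces of `K` is closed under
Painlevé–Kuratowski limits, then `K` is stable: if `w'` is close to `w = a • u + b • v`, then
`w' = a • u' + b • v'` with `u'` close to `u` and `v'` close to `v` (`exists_splitsNear`). Let `f` be
a horofunction, the limit of `ψ_z` along an ultrafilter. The epigraphical limit `B` of the scaled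
affine functions of `z` is convex, and stability says that it is concave as well
(`comb_le_of_mem_epiLimit`). Hence, by the Hahn–Banach theorem, finitely many affine functions below
`B` have a common affine majorant below `B`, up to factors close to `1` (`exists_gap_ge_finset`).
Since `gap o ξ` vanishes over `B`, a large multiple of it can be added. The points of `D` obtained
in this way from larger and larger finite sets of functions form a sequence `x` with `ψ_{x n} → f`
and `d b (x n) + f (x n) → 0`, and such a sequence has an almost-geodesic subsequence
(`exists_isAlmostGeodesic`).

**From Busemann points to closed faces.** Let faces `C n` converge to `L`. The function `funk o (C n)
· b` is a limit of Funk parts of functions `ψ_z`, again by the Hahn–Banach argument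
(`exists_abs_funk_sub_le`), and hence `f = funk o L · b + F ξ · - F ξ b` is a limit of functions
`ψ_z`, for some point `ξ`. If `f` is a Busemann point, or is itself one of the `ψ_z`, then there are
points `y` with `ψ_y → f` and `d b y + f y → 0`. The latter expression is the sum of two nonnegative
ones, one for each half of the distance, so both tend to `0`. The scaled affine functions of the
points `y` are then asymptotically at most `gap o b` on `L`, and at least any affine function that is
at most `gap o b` on `L`. If `L` contained an interior point of a segment of `K` having an end
outside `L`, an affine function separating this end from `L` would contradict this
(`isExtreme_of_tendsto`).
-/

/-! ### Painlevé–Kuratowski convergence in a metric space -/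

theorem isClosed_painleveKuratowski_iff {Y : Type*} [TopologicalSpace Y] {𝒮 : Set (Closeds Y)} :
    IsClosed[painleveKuratowskiTopology Y] 𝒮 ↔
      ∀ (C : ℕ → Closeds Y) (L : Closeds Y), (∀ n, C n ∈ 𝒮) → PKTendsto C L → L ∈ 𝒮 := by
  rw [← @isOpen_compl_iff _ _ (painleveKuratowskiTopology Y)]
  change 𝒮ᶜᶜ ∈ _ ↔ _
  rw [compl_compl]
  rfl

section PKMetric

variable {Y : Type*} [MetricSpace Y] {C : ℕ → Closeds Y} {L : Closeds Y} {x : Y}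

theorem PKTendsto.eventually_exists_dist_lt (h : PKTendsto C L) (hx : x ∈ (L : Set Y)) {ε : ℝ}
    (hε : 0 < ε) : ∀ᶠ n in atTop, ∃ y ∈ (C n : Set Y), dist y x < ε := by
  by_contra hn
  obtain ⟨φ, hφ, hφn⟩ := extraction_of_frequently_atTop (not_eventually.1 hn)
  rw [← h.2] at hx
  obtain ⟨y, hy, hd⟩ := Metric.mem_closure_iff.1 (mem_iInter.1 hx ⟨φ, hφ⟩) ε hε
  obtain ⟨i, hi⟩ := mem_iUnion.1 hy
  exact hφn i ⟨y, hi, by rwa [dist_comm]⟩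

theorem PKTendsto.mem_of_frequently (h : PKTendsto C L)
    (hx : ∀ ε > 0, ∃ᶠ n in atTop, ∃ y ∈ (C n : Set Y), dist y x < ε) : x ∈ (L : Set Y) := by
  rw [← h.1]
  refine mem_iInter.2 fun n => Metric.mem_closure_iff.2 fun ε hε => ?_
  obtain ⟨i, ⟨y, hy, hd⟩, hi⟩ := ((hx ε hε).and_eventually (eventually_gt_atTop n)).exists
  exact ⟨y, mem_iUnion₂.2 ⟨i, hi, hy⟩, by rwa [dist_comm]⟩

theorem pkTendsto_of_dist (h₁ : ∀ x ∈ (L : Set Y), ∀ ε > 0, ∀ᶠ n in atTop,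
      ∃ y ∈ (C n : Set Y), dist y x < ε)
    (h₂ : ∀ x, (∀ ε > 0, ∃ᶠ n in atTop, ∃ y ∈ (C n : Set Y), dist y x < ε) → x ∈ (L : Set Y)) :
    PKTendsto C L := by
  have hu : upperClosedLimit (fun n => (C n : Set Y)) ⊆ L := by
    intro x hx
    refine h₂ x fun ε hε => frequently_atTop.2 fun n => ?_
    obtain ⟨y, hy, hd⟩ := Metric.mem_closure_iff.1 (mem_iInter.1 hx n) ε hε
    obtain ⟨i, hi, hy⟩ := mem_iUnion₂.1 hy
    exact ⟨i, le_of_lt hi, y, hy, by rwa [dist_comm]⟩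
  have hl : (L : Set Y) ⊆ lowerClosedLimit (fun n => (C n : Set Y)) := by
    intro x hx
    refine mem_iInter.2 fun φ => Metric.mem_closure_iff.2 fun ε hε => ?_
    obtain ⟨i, y, hy, hd⟩ := (φ.2.tendsto_atTop.eventually (h₁ x hx ε hε)).exists
    exact ⟨y, mem_iUnion.2 ⟨i, hy⟩, by rwa [dist_comm]⟩
  have hlu := lowerClosedLimit_subset_upperClosedLimit (fun n => (C n : Set Y))
  exact ⟨hu.antisymm (hl.trans hlu), (hlu.trans hu).antisymm hl⟩

/-- Blaschke selection: convergence for the Hausdorff distance implies Painlevé–Kuratowski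
convergence, and the nonempty closed subsets of a compact set are compact for the former. -/
theorem exists_subseq_pkTendsto {K : Set Y} (hK : IsCompact K) (C : ℕ → Closeds Y)
    (hne : ∀ n, (C n : Set Y).Nonempty) (hCK : ∀ n, (C n : Set Y) ⊆ K) :
    ∃ (L : Closeds Y) (φ : ℕ → ℕ), StrictMono φ ∧ PKTendsto (fun n => C (φ n)) L := by
  let N : ℕ → NonemptyCompacts Y := fun n =>
    ⟨⟨C n, hK.of_isClosed_subset (C n).isClosed (hCK n)⟩, hne n⟩
  have hN : ∀ n, (N n : Set Y) = C n := fun n => rfl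
  obtain ⟨L, -, φ, hφ, hlim⟩ :=
    (NonemptyCompacts.isCompact_subsets_of_isCompact hK).tendsto_subseq (x := N) hCK
  have hfin : ∀ n, Metric.hausdorffEDist (N n : Set Y) L ≠ ⊤ := fun n =>
    Metric.hausdorffEDist_ne_top_of_nonempty_of_bounded (N n).nonempty L.nonempty
      (N n).isCompact.isBounded L.isCompact.isBounded
  have hd : ∀ ε > 0, ∀ᶠ n in atTop, Metric.hausdorffDist (N (φ n) : Set Y) L < ε := fun ε hε =>
    (Metric.tendsto_nhds.1 hlim ε hε).mono fun n hn => hn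
  refine ⟨⟨L, L.isCompact.isClosed⟩, φ, hφ, pkTendsto_of_dist ?_ ?_⟩
  · intro x hx ε hε
    filter_upwards [hd ε hε] with n hn
    exact Metric.exists_dist_lt_of_hausdorffDist_lt' hx hn (hfin _)
  · intro x hx
    refine L.isCompact.isClosed.closure_subset (Metric.mem_closure_iff.2 fun ε hε => ?_)
    obtain ⟨n, ⟨y, hy, hyx⟩, hn⟩ :=
      ((hx (ε / 2) (half_pos hε)).and_eventually (hd (ε / 2) (half_pos hε))).exists
    obtain ⟨z, hz, hyz⟩ := Metric.exists_dist_lt_of_hausdorffDist_lt hy hn (hfin _)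
    refine ⟨z, hz, ?_⟩
    calc dist x z ≤ dist y x + dist y z := by rw [dist_comm y x]; exact dist_triangle _ _ _
      _ < ε := by linarith

end PKMetric

/-! ### Stability of a compact convex set whose faces form a closed family -/

section Stability

variable {W : Type*} [NormedAddCommGroup W] [NormedSpace ℝ W] {K : Set W} {w : W}

/-- The directions in which one can move a little both ways from the point `w` of the convex set
`K` without leaving `K`; this is the direction of the affine span of the face generated by `w`. -/
def faceDirection (hK : Convex ℝ K) (hw : w ∈ K) : Submodule ℝ W where
  carrier := {y | ∃ t : ℝ, 0 < t ∧ w + t • y ∈ K ∧ w - t • y ∈ K}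
  zero_mem' := ⟨1, one_pos, by simpa using hw, by simpa using hw⟩
  add_mem' := by
    rintro y z ⟨s, hs, hy₁, hy₂⟩ ⟨t, ht, hz₁, hz₂⟩
    have hst : 0 < s + t := by positivity
    have h1 : t / (s + t) + s / (s + t) = 1 := by field_simp; ring
    refine ⟨s * t / (s + t), by positivity, ?_, ?_⟩
    · have := hK hy₁ hz₁ (a := t / (s + t)) (b := s / (s + t)) (by positivity) (by positivity) h1
      convert! this using 1
      match_scalars <;> field_simp
      ring
    · have := hK hy₂ hz₂ (a := t / (s + t)) (b := s / (s + t)) (by positivity) (by positivity) h1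
      convert! this using 1
      match_scalars <;> field_simp
      ring
  smul_mem' := by
    rintro c y ⟨t, ht, h₁, h₂⟩
    rcases lt_trichotomy c 0 with hc | rfl | hc
    · refine ⟨t / (-c), div_pos ht (by linarith), ?_, ?_⟩
      · convert! h₂ using 1; rw [smul_smul, div_neg, neg_mul, div_mul_cancel₀ _ hc.ne]; module
      · convert! h₁ using 1; rw [smul_smul, div_neg, neg_mul, div_mul_cancel₀ _ hc.ne]; module
    · exact ⟨1, one_pos, by simpa using hw, by simpa using hw⟩
    · refine ⟨t / c, div_pos ht hc, ?_, ?_⟩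
      · convert! h₁ using 1; rw [smul_smul, div_mul_cancel₀ _ hc.ne']
      · convert! h₂ using 1; rw [smul_smul, div_mul_cancel₀ _ hc.ne']

theorem faceDirection_le_of_mem_openSegment (hK : Convex ℝ K) (hw : w ∈ K) {x z : W} (hx : x ∈ K)
    (hz : z ∈ K) {a b : ℝ} (ha : 0 < a) (hb : 0 ≤ b) (hab : a + b = 1)
    (hwxz : w = a • x + b • z) : faceDirection hK hx ≤ faceDirection hK hw := by
  rintro y ⟨t, ht, h₁, h₂⟩
  refine ⟨a * t, by positivity, ?_, ?_⟩
  · convert! hK h₁ hz ha.le hb hab using 1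
    rw [hwxz]; module
  · convert! hK h₂ hz ha.le hb hab using 1
    rw [hwxz]; module

theorem exists_last_add_smul_mem (hc : IsCompact K) (hw : w ∈ K) {y : W} (hy : y ≠ 0) :
    ∃ t : ℝ, 0 ≤ t ∧ w + t • y ∈ K ∧ ∀ s, t < s → w + s • y ∉ K := by
  obtain ⟨R, hR0, hR⟩ := hc.isBounded.exists_pos_norm_le
  have hy' : 0 < ‖y‖ := norm_pos_iff.2 hy
  have hb : ∀ t : ℝ, w + t • y ∈ K → t ≤ 2 * R / ‖y‖ := by
    intro t ht
    rw [le_div_iff₀ hy']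
    calc t * ‖y‖ ≤ ‖t • y‖ := by rw [norm_smul]; gcongr; exact Real.le_norm_self t
      _ = ‖(w + t • y) - w‖ := by congr 1; module
      _ ≤ ‖w + t • y‖ + ‖w‖ := norm_sub_le _ _
      _ ≤ 2 * R := by linarith [hR _ ht, hR _ hw]
  have hcomp : IsCompact (Icc 0 (2 * R / ‖y‖) ∩ (fun t : ℝ => w + t • y) ⁻¹' K) :=
    isCompact_Icc.inter_right (hc.isClosed.preimage (by fun_prop))
  have h0 : w + (0 : ℝ) • y ∈ K := by simpa using hw
  obtain ⟨t, ⟨ht, htK⟩, hmax⟩ := hcomp.exists_isMaxOn ⟨0, ⟨le_rfl, hb 0 h0⟩, h0⟩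
    continuousOn_id
  exact ⟨t, ht.1, htK, fun s hs hsK => absurd (hmax ⟨⟨ht.1.trans hs.le, hb s hsK⟩, hsK⟩)
    (not_le.2 hs)⟩

variable [FiniteDimensional ℝ W]

/-- The face of `K` generated by the point `w` of `K`. -/
def generatedFace (hK : Convex ℝ K) (hcl : IsClosed K) (hw : w ∈ K) : Closeds W where
  carrier := {m | m ∈ K ∧ m - w ∈ faceDirection hK hw}
  isClosed' := hcl.inter ((Submodule.closed_of_finiteDimensional _).preimage
    (continuous_id.sub continuous_const))

theorem self_mem_generatedFace (hK : Convex ℝ K) (hcl : IsClosed K) (hw : w ∈ K) :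
    w ∈ (generatedFace hK hcl hw : Set W) :=
  ⟨hw, by rw [sub_self]; exact Submodule.zero_mem _⟩

theorem generatedFace_mem_extremeSets (hK : Convex ℝ K) (hcl : IsClosed K) (hw : w ∈ K) :
    generatedFace hK hcl hw ∈ extremeSets K := by
  refine ⟨?_, fun m hm => hm.1, ?_⟩
  · intro x hx y hy a b ha hb hab
    refine ⟨hK hx.1 hy.1 ha hb hab, ?_⟩
    have := Submodule.add_mem _ (Submodule.smul_mem _ a hx.2) (Submodule.smul_mem _ b hy.2)
    convert! this using 1
    rw [show a • (x - w) + b • (y - w) = a • x + b • y - (a + b) • w by module, hab, one_smul]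
  · rintro x hx y hy m ⟨hmK, t, ht, -, hm⟩ ⟨a, b, ha, hb, hab, rfl⟩
    refine ⟨hx, t * a / (1 + t), by positivity, ?_, ?_⟩
    · refine hK.add_smul_mem hw (by simpa using hx) ⟨by positivity, ?_⟩
      rw [div_le_one (by positivity)]
      nlinarith
    -- `w` lies between `w - t • (m - w)` and `m`, hence on a segment of `K` ending in `x`
    · have ht1 : 0 < 1 + t := by positivity
      have hz := hK hm hy (a := 1 / (1 + t * b)) (b := t * b / (1 + t * b)) (by positivity)
        (by positivity) (by field_simp)
      have := hK hw hz (a := t * a / (1 + t)) (b := 1 - t * a / (1 + t)) (by positivity)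
        (by rw [sub_nonneg, div_le_one ht1]; nlinarith) (by ring)
      have hb' : b = 1 - a := by linarith
      subst hb'
      have hne : 1 + t * (1 - a) ≠ 0 := by positivity
      convert! this using 1
      match_scalars <;> field_simp <;> ring

/-- The splitting `w = a • u + b • v` in `K` can be followed, up to `ε`, by a splitting of `w'`. -/
def SplitsNear (K : Set W) (a b : ℝ) (u v : W) (ε : ℝ) (w' : W) : Prop :=
  ∃ u' ∈ K, ∃ v' ∈ K, w' = a • u' + b • v' ∧ dist u' u < ε ∧ dist v' v < ε

variable {u v : W} {a b : ℝ}

/-- Points deep inside the faces that they generate split like a nearby point: the generated faces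
subconverge to a face, which contains `u` and `v`. -/
theorem exists_splitsNear_of_inner (hK : Convex ℝ K) (hc : IsCompact K)
    (hlim : ∀ (C : ℕ → Closeds W) (L : Closeds W), (∀ n, C n ∈ extremeSets K) → PKTendsto C L →
      L ∈ extremeSets K)
    (hu : u ∈ K) (hv : v ∈ K) (ha : 0 < a) (hb : 0 < b) (hab : a + b = 1)
    {r ε : ℝ} (hr : 0 < r) (hε : 0 < ε) :
    ∃ δ > 0, ∀ w' (hw' : w' ∈ K), (∀ y ∈ faceDirection hK hw', ‖y‖ < r → w' + y ∈ K) →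
      dist w' (a • u + b • v) < δ → SplitsNear K a b u v ε w' := by
  by_contra! hcon
  choose x hxK hxr hxd hxs using fun n : ℕ => hcon (1 / ((n : ℝ) + 1)) (by positivity)
  have hcl := hc.isClosed
  obtain ⟨L, φ, hφ, hL⟩ := exists_subseq_pkTendsto hc
    (fun n => generatedFace hK hcl (hxK n))
    (fun n => ⟨_, self_mem_generatedFace hK hcl (hxK n)⟩) (fun n m hm => hm.1)
  have hLext := hlim _ _ (fun n => generatedFace_mem_extremeSets hK hcl (hxK _)) hL
  have hxlim : ∀ ε > 0, ∀ᶠ n in atTop, dist (x (φ n)) (a • u + b • v) < ε := by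
    intro ε hε
    have h := (tendsto_one_div_add_atTop_nhds_zero_nat (𝕜 := ℝ)).comp hφ.tendsto_atTop
    filter_upwards [h.eventually (gt_mem_nhds hε)] with n hn
    exact (hxd (φ n)).trans hn
  have hwL : a • u + b • v ∈ (L : Set W) := hL.mem_of_frequently fun ε hε =>
    ((hxlim ε hε).mono fun n hn => ⟨_, self_mem_generatedFace hK hcl (hxK _), hn⟩).frequently
  have huL : u ∈ (L : Set W) :=
    hLext.2.left_mem_of_mem_openSegment hu hv hwL ⟨a, b, ha, hb, hab, rfl⟩
  have hvL : v ∈ (L : Set W) :=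
    hLext.2.right_mem_of_mem_openSegment hu hv hwL ⟨a, b, ha, hb, hab, rfl⟩
  obtain ⟨R, hR0, hR⟩ := hc.isBounded.exists_pos_norm_le
  obtain ⟨s, hs0, hs1, hsR⟩ : ∃ s : ℝ, 0 < s ∧ s < 1 ∧ s * (2 * R) < ε / 2 := by
    refine ⟨min (1 / 2) (ε / (8 * R)), by positivity,
      (min_le_left _ _).trans_lt (by norm_num), ?_⟩
    calc min (1 / 2) (ε / (8 * R)) * (2 * R) ≤ ε / (8 * R) * (2 * R) := by
          gcongr; exact min_le_right _ _
      _ = ε / 4 := by field_simp; norm_num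
      _ < ε / 2 := by linarith
  obtain ⟨η, hη0, hηε, hηr⟩ : ∃ η : ℝ, 0 < η ∧ η ≤ ε / 2 ∧ 2 * η < r * s :=
    ⟨min (ε / 2) (r * s / 4), by positivity, min_le_left _ _, by
      have := min_le_right (ε / 2) (r * s / 4)
      have : 0 < r * s := by positivity
      linarith⟩
  obtain ⟨n, ⟨u', hu', hdu⟩, ⟨v', hv', hdv⟩, hdx⟩ :=
    ((hL.eventually_exists_dist_lt huL hη0).and
      ((hL.eventually_exists_dist_lt hvL hη0).and (hxlim η hη0))).exists
  set p := x (φ n) with hp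
  set m := a • u' + b • v' with hm
  have hmF := (generatedFace_mem_extremeSets hK hcl (hxK (φ n))).1 hu' hv' ha.le hb.le hab
  have hmp : ‖p - m‖ < r * s := by
    have h1 : dist m (a • u + b • v) ≤ a * dist u' u + b * dist v' v := by
      rw [dist_eq_norm, dist_eq_norm, dist_eq_norm,
        show m - (a • u + b • v) = a • (u' - u) + b • (v' - v) by rw [hm]; module]
      refine (norm_add_le _ _).trans ?_
      rw [norm_smul, norm_smul, Real.norm_of_nonneg ha.le, Real.norm_of_nonneg hb.le]
    have h2 : a * dist u' u + b * dist v' v ≤ η := by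
      calc a * dist u' u + b * dist v' v ≤ a * η + b * η := by gcongr
        _ = η := by rw [← add_mul, hab, one_mul]
    have h3 := dist_triangle_right p m (a • u + b • v)
    rw [← dist_eq_norm]
    linarith
  -- the splitting of `m` is corrected by moving both ends a little towards a point of the face
  have hcor : p + ((1 - s) / s) • (p - m) ∈ K := by
    refine hxr (φ n) _ (Submodule.smul_mem _ _ ?_) ?_
    · rw [← neg_sub]; exact Submodule.neg_mem _ hmF.2
    · rw [norm_smul, Real.norm_of_nonneg (div_nonneg (by linarith) hs0.le), div_mul_eq_mul_div,
        div_lt_iff₀ hs0]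
      nlinarith [norm_nonneg (p - m)]
  set q := p + ((1 - s) / s) • (p - m) with hq
  have hclose : ∀ {y y' : W}, y' ∈ K → dist y' y < η → dist ((1 - s) • y' + s • q) y < ε := by
    intro y y' hy' hd
    rw [dist_eq_norm] at hd ⊢
    have h1 : (1 - s) • y' + s • q - y = (y' - y) + s • (q - y') := by module
    rw [h1]
    refine (norm_add_le _ _).trans_lt ?_
    rw [norm_smul, Real.norm_of_nonneg hs0.le]
    have h2 : ‖q - y'‖ ≤ 2 * R :=
      (norm_sub_le _ _).trans (by linarith [hR q hcor, hR y' hy'])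
    have h3 : s * ‖q - y'‖ ≤ s * (2 * R) := by gcongr
    linarith
  refine hxs (φ n) ⟨(1 - s) • u' + s • q, hK hu'.1 hcor (by linarith) hs0.le (by ring),
    (1 - s) • v' + s • q, hK hv'.1 hcor (by linarith) hs0.le (by ring), ?_,
    hclose hu'.1 hdu, hclose hv'.1 hdv⟩
  have h1 : a • ((1 - s) • u' + s • q) + b • ((1 - s) • v' + s • q)
      = (1 - s) • m + (a + b) • s • q := by rw [hm]; module
  have h2 : s • q = s • p + (1 - s) • (p - m) := by
    rw [hq, smul_add, smul_smul, mul_div_cancel₀ _ hs0.ne']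
  rw [h1, hab, one_smul, h2]
  module

/-- A compact convex set whose faces form a family that is closed for Painlevé–Kuratowski limits is
stable: convex combinations are open maps. A point close to the relative boundary of its generated
face lies on a segment between points with smaller generated faces, of which one is close by; this
allows an induction on the dimension of the generated face. -/
theorem exists_splitsNear (hK : Convex ℝ K) (hc : IsCompact K)
    (hlim : ∀ (C : ℕ → Closeds W) (L : Closeds W), (∀ n, C n ∈ extremeSets K) → PKTendsto C L →
      L ∈ extremeSets K)
    (hu : u ∈ K) (hv : v ∈ K) (ha : 0 < a) (hb : 0 < b) (hab : a + b = 1)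
    {ε : ℝ} (hε : 0 < ε) :
    ∃ δ > 0, ∀ w' ∈ K, dist w' (a • u + b • v) < δ → SplitsNear K a b u v ε w' := by
  suffices H : ∀ k : ℕ, ∀ ε > 0, ∃ δ > 0, ∀ w' (hw' : w' ∈ K),
      Module.finrank ℝ (faceDirection hK hw') < k → dist w' (a • u + b • v) < δ →
      SplitsNear K a b u v ε w' by
    obtain ⟨δ, hδ, h⟩ := H (Module.finrank ℝ W + 1) ε hε
    exact ⟨δ, hδ, fun w' hw' => h w' hw' (Nat.lt_succ_of_le (Submodule.finrank_le _))⟩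
  intro k
  induction k with
  | zero => exact fun ε _ => ⟨1, one_pos, fun w' _ h => absurd h (Nat.not_lt_zero _)⟩
  | succ k ih =>
    intro ε hε
    obtain ⟨R, hR0, hR⟩ := hc.isBounded.exists_pos_norm_le
    obtain ⟨δ₁, hδ₁, h₁⟩ := ih (ε / 2) (half_pos hε)
    obtain ⟨r, hr0, hrδ, hrε⟩ : ∃ r : ℝ, 0 < r ∧ r ≤ δ₁ / 4 ∧ r * (8 * R) ≤ ε * δ₁ :=
      ⟨min (δ₁ / 4) (ε * δ₁ / (8 * R)), by positivity, min_le_left _ _, by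
        rw [← le_div_iff₀ (by positivity)]; exact min_le_right _ _⟩
    obtain ⟨δ₂, hδ₂, h₂⟩ := exists_splitsNear_of_inner hK hc hlim hu hv ha hb hab hr0 hε
    refine ⟨min δ₂ (δ₁ / 4), by positivity, fun w' hw' hrank hd => ?_⟩
    have hdδ₁ : dist w' (a • u + b • v) < δ₁ / 4 := hd.trans_le (min_le_right _ _)
    by_cases hin : ∀ y ∈ faceDirection hK hw', ‖y‖ < r → w' + y ∈ K
    · exact h₂ w' hw' hin (hd.trans_le (min_le_left _ _))
    push Not at hin
    obtain ⟨y, hyS, hyr, hyK⟩ := hin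
    have hy0 : y ≠ 0 := by rintro rfl; exact hyK (by simpa using hw')
    obtain ⟨t₁, ht₁, hw₁, hmax₁⟩ := exists_last_add_smul_mem hc hw' hy0
    obtain ⟨t₂, ht₂, hw₂, hmax₂⟩ := exists_last_add_smul_mem hc hw' (neg_ne_zero.2 hy0)
    obtain ⟨τ, hτ, hτ₁, hτ₂⟩ := hyS
    have ht₁0 : 0 < t₁ := by
      by_contra h
      exact hmax₁ τ (by linarith) hτ₁
    have ht₂0 : 0 < t₂ := by
      by_contra h
      exact hmax₂ τ (by linarith) (by rwa [smul_neg, ← sub_eq_add_neg])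
    have ht₁1 : t₁ < 1 := by
      by_contra! h
      refine hyK ?_
      have := hK.add_smul_mem hw' hw₁ (t := 1 / t₁)
        ⟨by positivity, by rw [div_le_one ht₁0]; exact h⟩
      rwa [smul_smul, one_div_mul_cancel ht₁0.ne', one_smul] at this
    set w₁ := w' + t₁ • y with hw₁def
    set w₂ := w' + t₂ • -y with hw₂def
    set α := t₂ / (t₁ + t₂) with hα
    set β := t₁ / (t₁ + t₂) with hβ
    have hα0 : 0 < α := by positivity
    have hβ0 : 0 < β := by positivity
    have hαβ : α + β = 1 := by rw [hα, hβ]; field_simp; ring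
    have hcomb : w' = α • w₁ + β • w₂ := by
      rw [hw₁def, hw₂def, hα, hβ]
      match_scalars <;> field_simp <;> ring
    clear_value α β
    -- the two ends of the chord through `w'` generate smaller faces
    have hyS : y ∈ faceDirection hK hw' := ⟨τ, hτ, hτ₁, hτ₂⟩
    have hlt₁ : Module.finrank ℝ (faceDirection hK hw₁) < k := by
      refine lt_of_lt_of_le (Submodule.finrank_lt_finrank_of_lt (lt_of_le_of_ne
        (faceDirection_le_of_mem_openSegment hK hw' hw₁ hw₂ hα0 hβ0.le hαβ hcomb) ?_))
        (Nat.lt_succ_iff.1 hrank)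
      intro heq
      obtain ⟨s, hs, hs₁, -⟩ : y ∈ faceDirection hK hw₁ := heq ▸ hyS
      refine hmax₁ (t₁ + s) (by linarith) ?_
      rwa [add_smul, ← add_assoc]
    have hlt₂ : Module.finrank ℝ (faceDirection hK hw₂) < k := by
      refine lt_of_lt_of_le (Submodule.finrank_lt_finrank_of_lt (lt_of_le_of_ne
        (faceDirection_le_of_mem_openSegment hK hw' hw₂ hw₁ hβ0 hα0.le (by rw [add_comm, hαβ])
          (by rw [add_comm, ← hcomb])) ?_))
        (Nat.lt_succ_iff.1 hrank)
      intro heq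
      obtain ⟨s, hs, -, hs₂⟩ : y ∈ faceDirection hK hw₂ := heq ▸ hyS
      refine hmax₂ (t₂ + s) (by linarith) ?_
      rwa [add_smul, ← add_assoc, smul_neg s, ← sub_eq_add_neg]
    have hw₁w : dist w₁ w' < r := by
      rw [dist_eq_norm, hw₁def, add_sub_cancel_left, norm_smul, Real.norm_of_nonneg ht₁]
      nlinarith [norm_nonneg y]
    have hd₁ : dist w₁ (a • u + b • v) < δ₁ / 2 := by
      linarith [dist_triangle w₁ w' (a • u + b • v)]
    obtain ⟨u₁, hu₁, v₁, hv₁, hs₁, hdu₁, hdv₁⟩ := h₁ w₁ hw₁ hlt₁ (by linarith)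
    by_cases hfar : dist w₂ (a • u + b • v) < δ₁
    · obtain ⟨u₂, hu₂, v₂, hv₂, hs₂, hdu₂, hdv₂⟩ := h₁ w₂ hw₂ hlt₂ hfar
      have hclose : ∀ {x y₁ y₂ : W}, dist y₁ x < ε / 2 → dist y₂ x < ε / 2 →
          dist (α • y₁ + β • y₂) x < ε := by
        intro x y₁ y₂ h₁ h₂
        have := (convex_ball x (ε / 2)) (Metric.mem_ball.2 h₁) (Metric.mem_ball.2 h₂)
          hα0.le hβ0.le hαβ
        exact (Metric.mem_ball.1 this).trans (by linarith)
      refine ⟨α • u₁ + β • u₂, hK hu₁ hu₂ hα0.le hβ0.le hαβ, α • v₁ + β • v₂,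
        hK hv₁ hv₂ hα0.le hβ0.le hαβ, ?_, hclose hdu₁ hdu₂, hclose hdv₁ hdv₂⟩
      rw [hcomb, hs₁, hs₂]
      module
    -- if `w₂` is far away, then its weight `β` is small
    · have hβsmall : β * (2 * R) < ε / 2 := by
        have h3 : dist w₁ w₂ > δ₁ / 2 := by
          have := dist_triangle_left w₂ (a • u + b • v) w₁
          push Not at hfar
          linarith
        have h4 : β * dist w₁ w₂ = dist w₁ w' := by
          have h5 : w₁ - w' = β • (w₁ - w₂) := by
            rw [hcomb, show α = 1 - β by linarith]; module
          rw [dist_eq_norm, dist_eq_norm, h5, norm_smul, Real.norm_of_nonneg hβ0.le]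
        have h5 : β * (δ₁ / 2) < r := lt_of_le_of_lt (by gcongr) (h4.trans_lt hw₁w)
        have h6 : β * (δ₁ / 2) * (8 * R) < ε * δ₁ :=
          lt_of_lt_of_le (by gcongr) hrε
        have h7 : β * (2 * R) * δ₁ * 2 < ε * δ₁ := by linarith
        by_contra! h8
        nlinarith
      have hclose : ∀ {x y₁ : W}, y₁ ∈ K → dist y₁ x < ε / 2 → dist (α • y₁ + β • w₂) x < ε := by
        intro x y₁ hy₁ hd
        have h1 : α • y₁ + β • w₂ - x = (y₁ - x) + β • (w₂ - y₁) := by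
          rw [show α = 1 - β by linarith]; module
        rw [dist_eq_norm] at hd ⊢
        rw [h1]
        refine (norm_add_le _ _).trans_lt ?_
        rw [norm_smul, Real.norm_of_nonneg hβ0.le]
        have h2 : ‖w₂ - y₁‖ ≤ 2 * R :=
          (norm_sub_le _ _).trans (by linarith [hR w₂ hw₂, hR y₁ hy₁])
        have h3 : β * ‖w₂ - y₁‖ ≤ β * (2 * R) := by gcongr
        linarith
      refine ⟨α • u₁ + β • w₂, hK hu₁ hw₂ hα0.le hβ0.le hαβ, α • v₁ + β • w₂,
        hK hv₁ hw₂ hα0.le hβ0.le hαβ, ?_, hclose hu₁ hdu₁, hclose hv₁ hdv₁⟩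
      have : a • (α • u₁ + β • w₂) + b • (α • v₁ + β • w₂)
          = α • (a • u₁ + b • v₁) + (a + b) • β • w₂ := by module
      rw [this, ← hs₁, hab, one_smul, ← hcomb]

end Stability

/-! ### The polar of a bounded convex domain -/

section Polar

variable {E : Type*} [NormedAddCommGroup E] [NormedSpace ℝ E]

/-- `D` is a bounded open convex set containing the point `o`. -/
structure IsBoundedConvexDomain (D : Set E) (o : E) : Prop where
  isBounded : Bornology.IsBounded D
  isOpen : IsOpen D
  convex : Convex ℝ D
  mem : o ∈ D

/-- The value at `u` of the affine function `1 - u (x - o)` on the dual space. The points `x` of the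
domain are those for which it is positive on the polar. -/
def gap (o x : E) (u : StrongDual ℝ E) : ℝ := 1 - u (x - o)

/-- The largest ratio on `T` of the affine functions given by `x` and `y`. -/
noncomputable def gapRatio (o : E) (T : Set (StrongDual ℝ E)) (x y : E) : ℝ :=
  sSup ((fun u => gap o x u / gap o y u) '' T)

/-- The logarithm of `gapRatio`: the Funk distance from `x` to `y` when `T` is the polar. -/
noncomputable def funk (o : E) (T : Set (StrongDual ℝ E)) (x y : E) : ℝ :=
  Real.log (gapRatio o T x y)

variable {D : Set E} {o x y z : E} {T : Set (StrongDual ℝ E)} {u v : StrongDual ℝ E}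

theorem continuous_gap (o x : E) : Continuous (gap o x) := by
  unfold gap; fun_prop

theorem continuous_gap_left (o : E) (u : StrongDual ℝ E) : Continuous fun x => gap o x u := by
  unfold gap; fun_prop

@[simp] theorem gap_zero : gap o x 0 = 1 := by simp [gap]

theorem gap_comb {a b : ℝ} (hab : a + b = 1) :
    gap o x (a • u + b • v) = a * gap o x u + b * gap o x v := by
  have hb : b = 1 - a := by linarith
  subst hb
  simp only [gap, add_apply, smul_apply, smul_eq_mul]
  ring

theorem gap_comb_left {a b : ℝ} (hab : a + b = 1) :
    gap o (a • x + b • y) u = a * gap o x u + b * gap o y u := by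
  have hb : b = 1 - a := by linarith
  subst hb
  have : a • x + (1 - a) • y - o = a • (x - o) + (1 - a) • (y - o) := by module
  simp only [gap, this, map_add, map_smul, smul_eq_mul]
  ring

theorem mem_polarAt_iff : u ∈ polarAt D o ↔ ∀ x ∈ D, 0 ≤ gap o x u := by
  simp [polarAt, gap]

namespace IsBoundedConvexDomain

theorem zero_mem_polarAt (D : Set E) (o : E) : (0 : StrongDual ℝ E) ∈ polarAt D o := by
  simp [mem_polarAt_iff]

theorem convex_polarAt (D : Set E) (o : E) : Convex ℝ (polarAt D o) := by
  intro u hu v hv a b ha hb hab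
  rw [mem_polarAt_iff] at *
  intro x hx
  rw [gap_comb hab]
  have := hu x hx
  have := hv x hx
  positivity

theorem isClosed_polarAt (D : Set E) (o : E) : IsClosed (polarAt D o) := by
  have : polarAt D o = ⋂ x ∈ D, {u | 0 ≤ gap o x u} := by
    ext u; simp [mem_polarAt_iff]
  rw [this]
  exact isClosed_biInter fun x _ => isClosed_le continuous_const (continuous_gap o x)

theorem gap_pos (h : IsBoundedConvexDomain D o) (hx : x ∈ D) (hu : u ∈ polarAt D o) :
    0 < gap o x u := by
  -- `x` can be pushed a little further away from `o`
  have hc : ContinuousAt (fun t : ℝ => x + t • (x - o)) 0 := by fun_prop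
  have hev : ∀ᶠ t : ℝ in 𝓝[>] 0, x + t • (x - o) ∈ D :=
    (hc.eventually (h.isOpen.mem_nhds (by simpa using hx))).filter_mono nhdsWithin_le_nhds
  obtain ⟨t, htD, ht⟩ := (hev.and self_mem_nhdsWithin).exists
  have h1 := hu _ htD
  have h2 : x + t • (x - o) - o = (1 + t) • (x - o) := by module
  rw [h2, map_smul, smul_eq_mul] at h1
  have ht : 0 < t := ht
  unfold gap
  by_contra! h3
  nlinarith

theorem gap_nonneg_of_mem_closure (hx : x ∈ closure D) (hu : u ∈ polarAt D o) :
    0 ≤ gap o x u := by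
  have hcl : IsClosed {x | 0 ≤ gap o x u} := isClosed_le continuous_const (continuous_gap_left o u)
  exact hcl.closure_subset_iff.2 (fun y hy => mem_polarAt_iff.1 hu y hy) hx

theorem exists_gap_nonpos (h : IsBoundedConvexDomain D o) (hx : x ∉ D) :
    ∃ u ∈ polarAt D o, gap o x u ≤ 0 := by
  obtain ⟨f, hf⟩ := geometric_hahn_banach_open_point h.convex h.isOpen hx
  have hpos : 0 < f (x - o) := by rw [map_sub]; linarith [hf o h.mem]
  refine ⟨(f (x - o))⁻¹ • f, fun y hy => ?_, ?_⟩
  · rw [smul_apply, smul_eq_mul, inv_mul_le_one₀ hpos, map_sub, map_sub]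
    linarith [hf y hy]
  · simp only [gap, smul_apply, smul_eq_mul]
    rw [inv_mul_cancel₀ hpos.ne', sub_self]

theorem mem_of_gap_pos (h : IsBoundedConvexDomain D o) (hx : ∀ u ∈ polarAt D o, 0 < gap o x u) :
    x ∈ D := by
  by_contra hxD
  obtain ⟨u, hu, hle⟩ := h.exists_gap_nonpos hxD
  exact absurd (hx u hu) (not_lt.2 hle)

theorem continuousOn_gap_div (h : IsBoundedConvexDomain D o) (hTK : T ⊆ polarAt D o)
    (hy : y ∈ D) :
    ContinuousOn (fun u => gap o x u / gap o y u) T :=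
  (continuous_gap o x).continuousOn.div (continuous_gap o y).continuousOn
    fun _ hu => (h.gap_pos hy (hTK hu)).ne'

theorem exists_gap_pos (h : IsBoundedConvexDomain D o) (hne : T.Nonempty) (hTK : T ⊆ polarAt D o)
    (hx : x ∈ D) : ∃ u ∈ T, 0 < gap o x u :=
  hne.imp fun _ hu => ⟨hu, h.gap_pos hx (hTK hu)⟩

theorem exists_gap_pos_polarAt (D : Set E) (o x : E) : ∃ u ∈ polarAt D o, 0 < gap o x u :=
  ⟨0, zero_mem_polarAt D o, by simp⟩

section Compactness

variable [FiniteDimensional ℝ E]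

theorem isCompact_polarAt (h : IsBoundedConvexDomain D o) : IsCompact (polarAt D o) := by
  have : ProperSpace (StrongDual ℝ E) := FiniteDimensional.proper ℝ _
  refine Metric.isCompact_of_isClosed_isBounded (isClosed_polarAt D o) ?_
  obtain ⟨r, hr, hball⟩ := Metric.isOpen_iff.1 h.isOpen o h.mem
  refine (NormedSpace.isBounded_polar_of_mem_nhds_zero ℝ
    (Metric.ball_mem_nhds (0 : E) hr)).subset fun u hu => ?_
  have key : ∀ y : E, y ∈ Metric.ball (0 : E) r → u y ≤ 1 := fun y hy => by
    have := hu (o + y) (hball (by simpa using hy))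
    simpa using this
  rw [StrongDual.mem_polar_iff]
  intro y hy
  rw [Real.norm_eq_abs, abs_le]
  have := key (-y) (by simpa using hy)
  rw [map_neg] at this
  exact ⟨by linarith, key y hy⟩

theorem isCompact_closure (h : IsBoundedConvexDomain D o) : IsCompact (closure D) := by
  have : ProperSpace E := FiniteDimensional.proper ℝ _
  exact h.isBounded.isCompact_closure

theorem exists_gap_lower_bound (h : IsBoundedConvexDomain D o) (hx : x ∈ D) :
    ∃ c > 0, ∀ u ∈ polarAt D o, c ≤ gap o x u := by
  obtain ⟨u, hu, hmin⟩ := h.isCompact_polarAt.exists_isMinOn ⟨0, zero_mem_polarAt D o⟩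
    (continuous_gap o x).continuousOn
  exact ⟨gap o x u, h.gap_pos hx hu, fun v hv => hmin hv⟩

theorem exists_gap_lipschitz (h : IsBoundedConvexDomain D o) :
    ∃ R > 0, ∀ u ∈ polarAt D o, ∀ x y, gap o x u ≤ gap o y u + R * ‖x - y‖ := by
  obtain ⟨R, hR0, hR⟩ := h.isCompact_polarAt.isBounded.exists_pos_norm_le
  refine ⟨R, hR0, fun u hu x y => ?_⟩
  have h1 : |u (x - y)| ≤ R * ‖x - y‖ :=
    (u.le_opNorm _).trans (by gcongr; exact hR u hu)
  have h2 : u (x - o) = u (x - y) + u (y - o) := by rw [← map_add]; congr 1; module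
  unfold gap
  linarith [neg_abs_le (u (x - y))]

end Compactness

/-! ### The Funk distance -/

section GapRatio

variable (h : IsBoundedConvexDomain D o) (hT : IsCompact T) (hne : T.Nonempty)
  (hTK : T ⊆ polarAt D o)

include h hT hTK

theorem gap_le_gapRatio_mul (hy : y ∈ D) (hu : u ∈ T) :
    gap o x u ≤ gapRatio o T x y * gap o y u := by
  rw [← div_le_iff₀ (h.gap_pos hy (hTK hu))]
  exact le_csSup (hT.bddAbove_image (h.continuousOn_gap_div hTK hy)) (mem_image_of_mem _ hu)

include hne

theorem exists_gap_eq_gapRatio_mul (hy : y ∈ D) :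
    ∃ u ∈ T, gap o x u = gapRatio o T x y * gap o y u := by
  obtain ⟨u, hu, heq⟩ := hT.exists_sSup_image_eq hne (h.continuousOn_gap_div (x := x) hTK hy)
  exact ⟨u, hu, by rw [← div_eq_iff (h.gap_pos hy (hTK hu)).ne']; exact heq.symm⟩

theorem gapRatio_le_iff (hy : y ∈ D) {c : ℝ} :
    gapRatio o T x y ≤ c ↔ ∀ u ∈ T, gap o x u ≤ c * gap o y u := by
  constructor
  · intro hc u hu
    exact (h.gap_le_gapRatio_mul hT hTK hy hu).trans
      (mul_le_mul_of_nonneg_right hc (h.gap_pos hy (hTK hu)).le)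
  · intro hc
    obtain ⟨u, hu, heq⟩ := h.exists_gap_eq_gapRatio_mul hT hne hTK (x := x) hy
    exact le_of_mul_le_mul_right (heq ▸ hc u hu) (h.gap_pos hy (hTK hu))

theorem gapRatio_lt_iff (hy : y ∈ D) {c : ℝ} :
    gapRatio o T x y < c ↔ ∀ u ∈ T, gap o x u < c * gap o y u := by
  constructor
  · intro hc u hu
    exact (h.gap_le_gapRatio_mul hT hTK hy hu).trans_lt
      (mul_lt_mul_of_pos_right hc (h.gap_pos hy (hTK hu)))
  · intro hc
    obtain ⟨u, hu, heq⟩ := h.exists_gap_eq_gapRatio_mul hT hne hTK (x := x) hy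
    exact lt_of_mul_lt_mul_right (heq ▸ hc u hu) (h.gap_pos hy (hTK hu)).le

omit hne in
theorem gapRatio_pos (hx : ∃ u ∈ T, 0 < gap o x u) (hy : y ∈ D) : 0 < gapRatio o T x y := by
  obtain ⟨u, hu, hpos⟩ := hx
  by_contra! hle
  have h1 := h.gap_le_gapRatio_mul (x := x) hT hTK hy hu
  have h2 := h.gap_pos hy (hTK hu)
  nlinarith

theorem funk_le_iff (hx : ∃ u ∈ T, 0 < gap o x u) (hy : y ∈ D) {c : ℝ} :
    funk o T x y ≤ c ↔ ∀ u ∈ T, gap o x u ≤ Real.exp c * gap o y u := by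
  rw [← h.gapRatio_le_iff hT hne hTK hy, funk,
    Real.log_le_iff_le_exp (h.gapRatio_pos hT hTK hx hy)]

theorem gap_le_exp_funk_mul (hx : ∃ u ∈ T, 0 < gap o x u) (hy : y ∈ D) (hu : u ∈ T) :
    gap o x u ≤ Real.exp (funk o T x y) * gap o y u :=
  (h.funk_le_iff hT hne hTK hx hy).1 le_rfl u hu

theorem funk_le_sub_log (hx : ∃ u ∈ T, 0 < gap o x u) (hy : y ∈ D) {r : ℝ} (hr : 0 < r) {c : ℝ}
    (hle : ∀ u ∈ T, r * gap o x u ≤ Real.exp c * gap o y u) : funk o T x y ≤ c - Real.log r :=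
  (h.funk_le_iff hT hne hTK hx hy).2 fun u hu => by
    rw [Real.exp_sub, Real.exp_log hr, div_mul_eq_mul_div, le_div_iff₀ hr, mul_comm]
    exact hle u hu

theorem funk_self (hx : x ∈ D) : funk o T x x = 0 := by
  have hle : gapRatio o T x x ≤ 1 := (h.gapRatio_le_iff hT hne hTK hx).2 fun u _ => by simp
  obtain ⟨u, hu⟩ := hne
  have h1 := h.gap_le_gapRatio_mul (x := x) hT hTK hx hu
  have h2 : 1 ≤ gapRatio o T x x :=
    le_of_mul_le_mul_right (by rwa [one_mul]) (h.gap_pos hx (hTK hu))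
  rw [funk, le_antisymm hle h2, Real.log_one]

variable [FiniteDimensional ℝ E]

theorem funk_triangle (hx : ∃ u ∈ T, 0 < gap o x u) (hy : y ∈ D) (hz : z ∈ D) :
    funk o T x z ≤ funk o (polarAt D o) x y + funk o T y z := by
  refine (h.funk_le_iff hT hne hTK hx hz).2 fun u hu => ?_
  rw [Real.exp_add, mul_assoc]
  refine (h.gap_le_exp_funk_mul h.isCompact_polarAt ⟨0, zero_mem_polarAt D o⟩ Subset.rfl
    (hx.imp fun u hu => ⟨hTK hu.1, hu.2⟩) hy (hTK hu)).trans ?_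
  gcongr
  exact h.gap_le_exp_funk_mul hT hne hTK (h.exists_gap_pos hne hTK hy) hz hu

end GapRatio

variable [FiniteDimensional ℝ E]

theorem funk_nonneg (h : IsBoundedConvexDomain D o) (hy : y ∈ D) :
    0 ≤ funk o (polarAt D o) x y := by
  have h1 := h.gap_le_exp_funk_mul h.isCompact_polarAt ⟨0, zero_mem_polarAt D o⟩ Subset.rfl
    (exists_gap_pos_polarAt D o x) hy (zero_mem_polarAt D o)
  simpa using h1

theorem continuous_funk_left (h : IsBoundedConvexDomain D o) (hy : y ∈ D) :
    Continuous fun x => funk o (polarAt D o) x y := by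
  obtain ⟨R, hR0, hR⟩ := h.exists_gap_lipschitz
  obtain ⟨c, hc0, hc⟩ := h.exists_gap_lower_bound hy
  have hlip : LipschitzWith (R / c).toNNReal fun x => gapRatio o (polarAt D o) x y := by
    refine LipschitzWith.of_le_add_mul _ fun x z => ?_
    refine (h.gapRatio_le_iff h.isCompact_polarAt ⟨0, zero_mem_polarAt D o⟩ Subset.rfl hy).2
      fun u hu => ?_
    have h1 := h.gap_le_gapRatio_mul (x := z) h.isCompact_polarAt Subset.rfl hy hu
    have h2 := hR u hu x z
    have h3 : R * ‖x - z‖ ≤ R / c * dist x z * gap o y u := by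
      calc R * ‖x - z‖ = R / c * dist x z * c := by rw [dist_eq_norm]; field_simp
        _ ≤ _ := by gcongr; exact hc u hu
    rw [Real.coe_toNNReal _ (by positivity), add_mul]
    linarith
  exact hlip.continuous.log fun x => (h.gapRatio_pos h.isCompact_polarAt Subset.rfl
    (exists_gap_pos_polarAt D o x) hy).ne'

theorem tendsto_funk_right (h : IsBoundedConvexDomain D o) (hx : x ∈ D) :
    Tendsto (fun y : D => funk o (polarAt D o) x y) (𝓝 ⟨x, hx⟩) (𝓝 0) := by
  obtain ⟨R, hR0, hR⟩ := h.exists_gap_lipschitz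
  obtain ⟨c, hc0, hc⟩ := h.exists_gap_lower_bound hx
  have hcont : ∀ {k : ℝ}, Tendsto (fun y : D => k * ‖x - y‖) (𝓝 ⟨x, hx⟩) (𝓝 0) := by
    intro k
    have : Continuous fun y : D => k * ‖x - y‖ := by fun_prop
    simpa using this.tendsto ⟨x, hx⟩
  have hev : ∀ᶠ y : D in 𝓝 ⟨x, hx⟩, R / c * ‖x - y‖ < 1 :=
    hcont.eventually (gt_mem_nhds one_pos)
  have hupper : Tendsto (fun y : D => -Real.log (1 - R / c * ‖x - y‖)) (𝓝 ⟨x, hx⟩) (𝓝 0) := by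
    have := ((tendsto_const_nhds.sub (hcont (k := R / c))).log
      (show (1 : ℝ) - 0 ≠ 0 by norm_num)).neg
    simpa using this
  refine tendsto_of_tendsto_of_tendsto_of_le_of_le' tendsto_const_nhds hupper
    (Eventually.of_forall fun y => h.funk_nonneg y.2) ?_
  filter_upwards [hev] with y hy
  refine (h.funk_le_iff h.isCompact_polarAt ⟨0, zero_mem_polarAt D o⟩ Subset.rfl
    (exists_gap_pos_polarAt D o x) y.2).2 fun u hu => ?_
  have h1 := hR u hu x y
  have h2 : R * ‖x - y‖ ≤ R / c * ‖x - y‖ * gap o x u := by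
    calc R * ‖x - y‖ = R / c * ‖x - y‖ * c := by field_simp
      _ ≤ _ := by gcongr; exact hc u hu
  rw [Real.exp_neg, Real.exp_log (by linarith), ← div_eq_inv_mul, le_div_iff₀ (by linarith)]
  linarith

/-! ### The Hilbert distance is the symmetrised Funk distance -/

/-- Along the ray from `x` through `y`, the domain is left at the parameter determined by
`gapRatio`. -/
theorem isLUB_exit (h : IsBoundedConvexDomain D o) (hx : x ∈ D) (hy : y ∈ D) (hxy : x ≠ y) :
    1 < gapRatio o (polarAt D o) x y ∧
    IsLUB {s : ℝ | x + s • (y - x) ∈ D}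
      (gapRatio o (polarAt D o) x y / (gapRatio o (polarAt D o) x y - 1)) := by
  set M := gapRatio o (polarAt D o) x y with hM
  have hne : (polarAt D o).Nonempty := ⟨0, zero_mem_polarAt D o⟩
  have hgap : ∀ (t : ℝ) u, gap o (x + t • (y - x)) u = t * gap o y u - (t - 1) * gap o x u := by
    intro t u
    rw [show x + t • (y - x) = t • y + (1 - t) • x by module, gap_comb_left (by ring)]
    ring
  have hmem : ∀ t : ℝ, 1 < t → (x + t • (y - x) ∈ D ↔ M * (t - 1) < t) := by
    intro t ht
    rw [← lt_div_iff₀ (by linarith), hM, h.gapRatio_lt_iff h.isCompact_polarAt hne Subset.rfl hy]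
    constructor
    · intro htD u hu
      have := h.gap_pos htD hu
      rw [hgap] at this
      rw [div_mul_eq_mul_div, lt_div_iff₀ (by linarith)]
      linarith
    · intro hall
      refine h.mem_of_gap_pos fun u hu => ?_
      have := hall u hu
      rw [div_mul_eq_mul_div, lt_div_iff₀ (by linarith)] at this
      rw [hgap]
      linarith
  have hM1 : 1 < M := by
    by_contra! hle
    obtain ⟨R, hR0, hR⟩ := h.isBounded.exists_pos_norm_le
    have hyx : 0 < ‖y - x‖ := norm_pos_iff.2 (sub_ne_zero.2 hxy.symm)
    set t := 2 * R / ‖y - x‖ + 2 with ht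
    have ht1 : 1 < t := by
      have : 0 < 2 * R / ‖y - x‖ := by positivity
      linarith
    have htD := (hmem t ht1).2 (by nlinarith)
    have h1 : ‖t • (y - x)‖ ≤ 2 * R := by
      calc ‖t • (y - x)‖ = ‖(x + t • (y - x)) - x‖ := by rw [add_sub_cancel_left]
        _ ≤ _ := norm_sub_le _ _
        _ ≤ 2 * R := by linarith [hR _ htD, hR _ hx]
    rw [norm_smul, Real.norm_of_nonneg (by linarith), ht, add_mul,
      div_mul_cancel₀ _ hyx.ne'] at h1
    linarith
  refine ⟨hM1, ?_, ?_⟩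
  · intro t ht
    rw [le_div_iff₀ (by linarith)]
    rcases le_or_gt t 1 with h1 | h1
    · nlinarith
    · have := (hmem t h1).1 ht
      linarith
  · intro c hc
    have h1c : 1 < M / (M - 1) := by rw [lt_div_iff₀ (by linarith)]; linarith
    refine le_of_forall_lt fun t ht => ?_
    obtain ⟨s, hs, hs'⟩ := exists_between (max_lt ht h1c)
    refine (le_max_left t 1).trans_lt (hs.trans_le (hc ?_))
    rw [lt_div_iff₀ (by linarith)] at hs'
    exact (hmem s ((le_max_right t 1).trans_lt hs)).2 (by linarith)

theorem norm_exitPoint_div (h : IsBoundedConvexDomain D o) (hx : x ∈ D) (hy : y ∈ D)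
    (hxy : x ≠ y) :
    ‖exitPoint D x y - x‖ / ‖exitPoint D x y - y‖ = gapRatio o (polarAt D o) x y := by
  obtain ⟨hM, hlub⟩ := h.isLUB_exit hx hy hxy
  have hsup := hlub.csSup_eq ⟨0, by simpa using hx⟩
  set M := gapRatio o (polarAt D o) x y
  have hyx : 0 < ‖y - x‖ := norm_pos_iff.2 (sub_ne_zero.2 hxy.symm)
  have hM1 : 0 < M - 1 := by linarith
  have h1 : exitPoint D x y - x = (M / (M - 1)) • (y - x) := by
    rw [exitPoint, hsup]; module
  have h2 : exitPoint D x y - y = (1 / (M - 1)) • (y - x) := by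
    rw [exitPoint, hsup]; match_scalars <;> field_simp <;> ring
  rw [h1, h2, norm_smul, norm_smul, Real.norm_of_nonneg (by positivity),
    Real.norm_of_nonneg (by positivity)]
  field_simp

theorem hilbertDist_eq (h : IsBoundedConvexDomain D o) (x y : D) :
    hilbertDist D x y = funk o (polarAt D o) x y + funk o (polarAt D o) y x := by
  have hne : (polarAt D o).Nonempty := ⟨0, zero_mem_polarAt D o⟩
  unfold hilbertDist
  split_ifs with hxy
  · subst hxy
    rw [h.funk_self h.isCompact_polarAt hne Subset.rfl x.2, add_zero]
  · have hxy' : (x : E) ≠ y := fun he => hxy (Subtype.ext he)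
    rw [h.norm_exitPoint_div x.2 y.2 hxy', h.norm_exitPoint_div y.2 x.2 hxy'.symm, funk, funk,
      Real.log_mul (h.gapRatio_pos h.isCompact_polarAt Subset.rfl
        (exists_gap_pos_polarAt D o x) y.2).ne' (h.gapRatio_pos h.isCompact_polarAt Subset.rfl
        (exists_gap_pos_polarAt D o y) x.2).ne']

end IsBoundedConvexDomain
end Polar

/-! ### Busemann points and sequences -/

section Busemann

variable {X : Type*} {d : X → X → ℝ} {b : X} {f : X → ℝ}

theorem asUniformOnBounded_apply_tendsto (hself : ∀ x, d x x = 0) {ι : Type*} {l : Filter ι}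
    {g : ι → X → ℝ}
    (h : Tendsto (fun i => asUniformOnBounded d (g i)) l (𝓝 (asUniformOnBounded d f))) (x : X) :
    Tendsto (fun i => g i x) l (𝓝 (f x)) := by
  rw [UniformOnFun.tendsto_iff_tendstoUniformlyOn] at h
  have hx : ({x} : Set X) ∈ symBoundedSets d := ⟨0, by rintro _ rfl _ rfl; simp [symDist, hself]⟩
  exact (h {x} hx).tendsto_at rfl

/-- Along an almost-geodesic converging to `f`, the point at time `t` is asymptotically as far from
the base-point as `f` decreases there. -/
theorem IsAlmostGeodesic.tendsto_dist_add (hself : ∀ x, d x x = 0) {T : Set ℝ} {γ : T → X}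
    (hγ : IsAlmostGeodesic d T γ)
    (hlim : ∀ x, Tendsto (fun t : T => distFun d b (γ t) x) atTop (𝓝 (f x))) :
    Tendsto (fun t : T => d b (γ t) + f (γ t)) atTop (𝓝 0) := by
  obtain ⟨-, -, h0, hγ⟩ := hγ
  have : Nonempty T := ⟨⟨0, h0⟩⟩
  set y := γ ⟨0, h0⟩
  have h1 : Tendsto (fun t : T => d y (γ t) + f (γ t) - f y) atTop (𝓝 0) := by
    refine Metric.tendsto_atTop.2 fun ε hε => ?_
    obtain ⟨t₀, ht₀⟩ := hγ (ε / 4) (by positivity)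
    refine ⟨t₀, fun s hs => ?_⟩
    have hl : Tendsto (fun t : T => |d y (γ s) + distFun d b (γ t) (γ s) - distFun d b (γ t) y|)
        atTop (𝓝 |d y (γ s) + f (γ s) - f y|) :=
      ((tendsto_const_nhds.add (hlim _)).sub (hlim _)).abs
    have hle : |d y (γ s) + f (γ s) - f y| ≤ ε / 2 := by
      refine le_of_tendsto hl ?_
      filter_upwards [eventually_ge_atTop s] with t hst
      have h2 := ht₀ s t hs hst
      have h3 := ht₀ t t (hs.trans hst) le_rfl
      rw [hself, add_zero] at h3
      rw [abs_lt] at h2 h3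
      unfold distFun
      rw [abs_le]
      constructor <;> linarith
    rw [Real.dist_eq, sub_zero]
    linarith
  have h2 := h1.sub ((hlim y).sub_const (f y))
  simp only [sub_self] at h2
  refine h2.congr fun t => ?_
  unfold distFun
  ring

/-- A sequence converging to `f` that escapes to infinity in the way an almost-geodesic does has an
almost-geodesic as a subsequence, parametrised by the distance to its starting point. -/
theorem exists_isAlmostGeodesic (hself : ∀ x, d x x = 0) {x : ℕ → X}
    (hlim : Tendsto (fun n => asUniformOnBounded d (distFun d b (x n))) atTop
      (𝓝 (asUniformOnBounded d f)))
    (hinf : Tendsto (fun n => d b (x n)) atTop atTop)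
    (hf : Tendsto (fun n => d b (x n) + f (x n)) atTop (𝓝 0)) :
    ∃ (T : Set ℝ) (γ : T → X), IsAlmostGeodesic d T γ ∧
      Tendsto (fun t : T => asUniformOnBounded d (distFun d b (γ t))) atTop
        (𝓝 (asUniformOnBounded d f)) := by
  have hpt := asUniformOnBounded_apply_tendsto hself hlim
  have hdiff : ∀ y, Tendsto (fun n => d y (x n) - d (x 0) (x n)) atTop (𝓝 (f y - f (x 0))) :=
    fun y => ((hpt y).sub (hpt (x 0))).congr fun n => by unfold distFun; ring
  have hinf₀ : Tendsto (fun n => d (x 0) (x n)) atTop atTop :=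
    (hinf.atTop_add (hpt (x 0))).congr fun n => by unfold distFun; ring
  have hN : ∀ n : ℕ, ∃ N, ∀ m ≥ N, d (x 0) (x n) < d (x 0) (x m) ∧
      |d (x n) (x m) - d (x 0) (x m) - (f (x n) - f (x 0))| < 1 / ((n : ℝ) + 1) := by
    intro n
    refine eventually_atTop.1 ((hinf₀.eventually_gt_atTop _).and ?_)
    have h1 := (Metric.tendsto_nhds.1 (hdiff (x n))) (1 / ((n : ℝ) + 1)) (by positivity)
    filter_upwards [h1] with m hm
    rwa [Real.dist_eq] at hm
  choose N hN₁ using hN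
  let φ : ℕ → ℕ := fun k => (fun n => max (N n) (n + 1))^[k] 0
  have hφs : ∀ k, φ (k + 1) = max (N (φ k)) (φ k + 1) := fun k =>
    Function.iterate_succ_apply' _ _ _
  have hφ : StrictMono φ := strictMono_nat_of_lt_succ fun k => by
    rw [hφs]; exact lt_of_lt_of_le (Nat.lt_succ_self _) (le_max_right _ _)
  have hφN : ∀ {k l}, k < l → N (φ k) ≤ φ l := fun {k l} hkl =>
    calc N (φ k) ≤ φ (k + 1) := by rw [hφs]; exact le_max_left _ _
      _ ≤ φ l := hφ.monotone hkl
  let t : ℕ → ℝ := fun k => d (x 0) (x (φ k))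
  have ht : StrictMono t := fun k l hkl => (hN₁ _ _ (hφN hkl)).1
  let e : ℕ ≃o range t := ht.orderIso
  have he : ∀ k, (e k : ℝ) = t k := fun k => rfl
  have het : ∀ s : range t, t (e.symm s) = s := fun s => by rw [← he, e.apply_symm_apply]
  have ht0 : t 0 = 0 := hself _
  have h0mem : (0 : ℝ) ∈ range t := ⟨0, ht0⟩
  refine ⟨range t, fun s => x (φ (e.symm s)), ⟨?_, ?_, h0mem, ?_⟩, ?_⟩
  · rintro _ ⟨k, rfl⟩
    exact mem_Ici.2 (ht0 ▸ ht.monotone (Nat.zero_le k))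
  · rintro _ ⟨k, rfl⟩
    exact ⟨t (k + 1), ⟨k + 1, rfl⟩, ht (Nat.lt_succ_self k)⟩
  · have h00 : e.symm ⟨0, h0mem⟩ = 0 := by
      rw [OrderIso.symm_apply_eq]; exact Subtype.ext ht0.symm
    change ∀ ε > 0, ∃ t₀ : range t, ∀ s s' : range t, t₀ ≤ s → s ≤ s' →
      |d (x (φ (e.symm ⟨0, h0mem⟩))) (x (φ (e.symm s))) + d (x (φ (e.symm s))) (x (φ (e.symm s'))) - (s' : ℝ)| < ε
    rw [h00]
    change ∀ ε > 0, ∃ t₀ : range t, ∀ s s' : range t, t₀ ≤ s → s ≤ s' →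
      |d (x 0) (x (φ (e.symm s))) + d (x (φ (e.symm s))) (x (φ (e.symm s'))) - (s' : ℝ)| < ε
    intro ε hε
    have h1 : Tendsto (fun n => d (x 0) (x n) + f (x n) - f (x 0)) atTop (𝓝 0) := by
      have := hf.add ((hpt (x 0)).sub_const (f (x 0)))
      simp only [sub_self, add_zero] at this
      refine this.congr fun n => ?_
      unfold distFun; ring
    obtain ⟨n₁, hn₁⟩ := Metric.tendsto_atTop.1 h1 (ε / 2) (half_pos hε)
    obtain ⟨n₂, hn₂⟩ := Metric.tendsto_atTop.1 (tendsto_one_div_add_atTop_nhds_zero_nat (𝕜 := ℝ))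
      (ε / 2) (half_pos hε)
    refine ⟨e (max n₁ n₂), fun s s' hs hss' => ?_⟩
    rw [← het s']
    have hk := (OrderIso.le_symm_apply e).2 hs
    have hkl := e.symm.monotone hss'
    generalize e.symm s = k at *
    generalize e.symm s' = l at *
    have hφk : max n₁ n₂ ≤ φ k := hk.trans (hφ.le_apply)
    rcases hkl.eq_or_lt with rfl | hlt
    · rw [hself, add_zero]
      change |t k - t k| < ε
      simpa using hε
    · have h3 := hn₁ (φ k) ((le_max_left _ _).trans hφk)
      have h4 := hn₂ (φ k) ((le_max_right _ _).trans hφk)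
      have h5 := (hN₁ _ _ (hφN hlt)).2
      rw [Real.dist_eq, sub_zero] at h3 h4
      have h6 := (le_abs_self _).trans_lt h4
      rw [abs_lt] at h3 h5
      change |_ - d (x 0) (x (φ l))| < ε
      rw [abs_lt]
      constructor <;> linarith
  · exact hlim.comp (hφ.tendsto_atTop.comp e.symm.tendsto_atTop)

end Busemann

/-! ### The topology of the Hilbert distance -/

theorem hilbertDist_self {E : Type*} [NormedAddCommGroup E] [NormedSpace ℝ E] {D : Set E} (x : D) :
    hilbertDist D x x = 0 := by
  simp [hilbertDist]

namespace IsBoundedConvexDomain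

variable {E : Type*} [NormedAddCommGroup E] [NormedSpace ℝ E] [FiniteDimensional ℝ E]
  {D : Set E} {o : E}

theorem hilbertDist_comm (h : IsBoundedConvexDomain D o) (x y : D) :
    hilbertDist D x y = hilbertDist D y x := by
  rw [h.hilbertDist_eq, h.hilbertDist_eq, add_comm]

theorem funk_triangle' (h : IsBoundedConvexDomain D o) (x : E) {y z : E} (hy : y ∈ D)
    (hz : z ∈ D) :
    funk o (polarAt D o) x z ≤ funk o (polarAt D o) x y + funk o (polarAt D o) y z :=
  h.funk_triangle h.isCompact_polarAt ⟨0, zero_mem_polarAt D o⟩ Subset.rfl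
    (exists_gap_pos_polarAt D o x) hy hz

theorem hilbertDist_triangle (h : IsBoundedConvexDomain D o) (x y z : D) :
    hilbertDist D x z ≤ hilbertDist D x y + hilbertDist D y z := by
  simp only [h.hilbertDist_eq]
  linarith [h.funk_triangle' x y.2 z.2, h.funk_triangle' z y.2 x.2]

theorem abs_distFun_sub_le (h : IsBoundedConvexDomain D o) (b z x y : D) :
    |distFun (hilbertDist D) b z x - distFun (hilbertDist D) b z y| ≤ hilbertDist D x y := by
  unfold distFun
  rw [abs_le]
  have h1 := h.hilbertDist_triangle x y z
  have h2 := h.hilbertDist_triangle y x z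
  rw [h.hilbertDist_comm y x] at h2
  constructor <;> linarith

theorem tendsto_hilbertDist (h : IsBoundedConvexDomain D o) (x : D) :
    Tendsto (fun y : D => hilbertDist D x y) (𝓝 x) (𝓝 0) := by
  simp only [h.hilbertDist_eq]
  have h1 := h.tendsto_funk_right x.2
  have h2 := ((h.continuous_funk_left x.2).comp continuous_subtype_val).tendsto x
  have h3 := h.funk_self h.isCompact_polarAt ⟨0, zero_mem_polarAt D o⟩ Subset.rfl x.2
  simp only [Function.comp_apply, h3] at h2
  simpa using h1.add h2

theorem exists_isCompact_of_mem_symBoundedSets (h : IsBoundedConvexDomain D o) {B : Set D}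
    (hB : B ∈ symBoundedSets (hilbertDist D)) : ∃ Q : Set D, IsCompact Q ∧ B ⊆ Q := by
  rcases B.eq_empty_or_nonempty with rfl | ⟨x, hx⟩
  · exact ⟨∅, isCompact_empty, Subset.rfl⟩
  obtain ⟨r, hr⟩ := hB
  let Q : Set E := {y | ∀ u ∈ polarAt D o, gap o x u ≤ Real.exp (r / 2) * gap o y u}
  have hQD : Q ⊆ D := fun y hy => h.mem_of_gap_pos fun u hu => by
    have h1 := hy u hu
    have h2 := h.gap_pos x.2 hu
    exact pos_of_mul_pos_right (h2.trans_le h1) (Real.exp_pos _).le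
  have hQcl : IsClosed Q := by
    have : Q = ⋂ u ∈ polarAt D o, {y | gap o x u ≤ Real.exp (r / 2) * gap o y u} := by
      ext y; simp [Q]
    rw [this]
    exact isClosed_biInter fun u _ => isClosed_le continuous_const
      (continuous_const.mul (continuous_gap_left o u))
  have hQ : IsCompact Q :=
    h.isCompact_closure.of_isClosed_subset hQcl (hQD.trans subset_closure)
  refine ⟨Subtype.val ⁻¹' Q, ?_, fun y hy => ?_⟩
  · rw [Subtype.isCompact_iff, image_preimage_eq_of_subset (by simpa using hQD)]
    exact hQ
  · have h1 := hr x hx y hy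
    unfold symDist at h1
    rw [h.hilbertDist_comm y x, h.hilbertDist_eq] at h1
    have h2 := h.funk_nonneg (x := (y : E)) x.2
    exact (h.funk_le_iff h.isCompact_polarAt ⟨0, zero_mem_polarAt D o⟩ Subset.rfl
      (exists_gap_pos_polarAt D o x) y.2).1 (by linarith)

/-- For functions that are `1`-Lipschitz for the Hilbert distance, pointwise convergence on a dense
set is uniform on bounded sets, since bounded sets are relatively compact. -/
theorem tendsto_asUniformOnBounded (h : IsBoundedConvexDomain D o) {ι : Type*} {l : Filter ι}
    {g : ι → D → ℝ} {f : D → ℝ} (hg : ∀ i x y, |g i x - g i y| ≤ hilbertDist D x y)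
    (hf : ∀ x y, |f x - f y| ≤ hilbertDist D x y) {S : Set D} (hS : Dense S)
    (hlim : ∀ x ∈ S, Tendsto (fun i => g i x) l (𝓝 (f x))) :
    Tendsto (fun i => asUniformOnBounded (hilbertDist D) (g i)) l
      (𝓝 (asUniformOnBounded (hilbertDist D) f)) := by
  rw [UniformOnFun.tendsto_iff_tendstoUniformlyOn]
  intro B hB
  obtain ⟨Q, hQ, hBQ⟩ := h.exists_isCompact_of_mem_symBoundedSets hB
  refine TendstoUniformlyOn.mono ?_ hBQ
  rw [Metric.tendstoUniformlyOn_iff]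
  intro ε hε
  change ∀ᶠ i in l, ∀ x ∈ Q, dist (f x) (g i x) < ε
  refine hQ.induction_on (p := fun s => ∀ᶠ i in l, ∀ x ∈ s, dist (f x) (g i x) < ε) (by simp)
    (fun s t hst ht => ht.mono fun i hi x hx => hi x (hst hx)) (fun s t hs ht => ?_)
    (fun x _ => ?_)
  · filter_upwards [hs, ht] with i hi hi' x hx using hx.elim (hi x) (hi' x)
  · have hev := (h.tendsto_hilbertDist x).eventually (gt_mem_nhds (show (0 : ℝ) < ε / 5 by linarith))
    obtain ⟨s, hsS, hs⟩ := hS.inter_nhds_nonempty hev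
    refine ⟨_, mem_nhdsWithin_of_mem_nhds hev, ?_⟩
    filter_upwards [Metric.tendsto_nhds.1 (hlim s hsS) (ε / 5) (by linarith)] with i hi y hy
    have h1 : hilbertDist D y s < 2 * (ε / 5) := by
      have h2 := h.hilbertDist_triangle y x s
      rw [h.hilbertDist_comm y x] at h2
      have h3 : hilbertDist D x y < ε / 5 := hy
      have h4 : hilbertDist D x s < ε / 5 := hs
      linarith
    have h2 := (hg i y s).trans_lt h1
    have h3 := (hf y s).trans_lt h1
    rw [Real.dist_eq] at hi ⊢
    rw [abs_lt] at hi h2 h3 ⊢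
    constructor <;> linarith

end IsBoundedConvexDomain

/-! ### Affine functions between a set of positive affine functions and a convex set -/

namespace IsBoundedConvexDomain

variable {E : Type*} [NormedAddCommGroup E] [NormedSpace ℝ E] [FiniteDimensional ℝ E]
  {D : Set E} {o : E}

theorem exists_eval_eq (Ψ : StrongDual ℝ (StrongDual ℝ E)) :
    ∃ y : E, ∀ u : StrongDual ℝ E, Ψ u = u y := by
  let φ : Module.Dual ℝ (Module.Dual ℝ E) :=
    Ψ.toLinearMap ∘ₗ (LinearMap.toContinuousLinearMap (𝕜 := ℝ) (E := E) (F' := ℝ)).toLinearMap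
  refine ⟨(Module.evalEquiv ℝ E).symm φ, fun u => ?_⟩
  have h1 := Module.apply_evalEquiv_symm_apply ℝ E u.toLinearMap φ
  have h2 : φ u.toLinearMap = Ψ u := by
    change Ψ (LinearMap.toContinuousLinearMap u.toLinearMap) = Ψ u
    congr 1
  rw [← h2, ← h1]
  rfl

/-- Up to a factor, the affine functions that are positive on the polar are the points of `D`. -/
theorem exists_mul_gap_eq (h : IsBoundedConvexDomain D o) (Ψ : StrongDual ℝ (StrongDual ℝ E))
    {c : ℝ} (hpos : ∀ u ∈ polarAt D o, 0 < c - Ψ u) :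
    ∃ r > 0, ∃ x ∈ D, ∀ u, c - Ψ u = r * gap o x u := by
  obtain ⟨y, hy⟩ := exists_eval_eq Ψ
  have hc : 0 < c := by simpa using hpos 0 (zero_mem_polarAt D o)
  have heq : ∀ u, c - Ψ u = c * gap o (o + c⁻¹ • y) u := fun u => by
    rw [gap, add_sub_cancel_left, map_smul, smul_eq_mul, hy, mul_sub, mul_one,
      mul_inv_cancel_left₀ hc.ne']
  refine ⟨c, hc, _, h.mem_of_gap_pos fun u hu => ?_, heq⟩
  have := hpos u hu
  rw [heq] at this
  exact pos_of_mul_pos_right this hc.le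

variable {B : Set (StrongDual ℝ E × ℝ)}

/-- If the joins of the graphs of two positive affine functions stay below the closed convex set
`B`, then the two functions, multiplied by any factor less than `1`, have a common affine majorant below
`B`. -/
theorem exists_gap_sandwich (h : IsBoundedConvexDomain D o) (hBc : Convex ℝ B) (hBcl : IsClosed B)
    (hBne : B.Nonempty) (hBK : ∀ p ∈ B, p.1 ∈ polarAt D o) {x y : E} (hx : x ∈ D) (hy : y ∈ D)
    {s t : ℝ} (hs : 0 < s) (ht : 0 < t)
    (hcomb : ∀ u ∈ polarAt D o, ∀ v ∈ polarAt D o, ∀ a b c : ℝ, 0 ≤ a → 0 ≤ b → a + b = 1 →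
      (a • u + b • v, c) ∈ B → a * (s * gap o x u) + b * (t * gap o y v) ≤ c)
    {η : ℝ} (hη0 : 0 < η) (hη1 : η < 1) :
    ∃ r > 0, ∃ z ∈ D, (∀ p ∈ B, r * gap o z p.1 < p.2) ∧
      (∀ u ∈ polarAt D o, (1 - η) * (s * gap o x u) ≤ r * gap o z u) ∧
      (∀ u ∈ polarAt D o, (1 - η) * (t * gap o y u) ≤ r * gap o z u) := by
  set K := polarAt D o with hK
  have hη : 0 < 1 - η := by linarith
  let P : ℝ → E → StrongDual ℝ E → StrongDual ℝ E × ℝ := fun s x u => (u, (1 - η) * (s * gap o x u))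
  have hPcont : ∀ s x, Continuous (P s x) := fun s x =>
    continuous_id.prodMk (continuous_const.mul (continuous_const.mul (continuous_gap o x)))
  have hPconv : ∀ s x, Convex ℝ (P s x '' K) := by
    rintro s x _ ⟨u, hu, rfl⟩ _ ⟨v, hv, rfl⟩ a b ha hb hab
    refine ⟨a • u + b • v, convex_polarAt D o hu hv ha hb hab, ?_⟩
    simp only [P, gap_comb hab, Prod.smul_mk, Prod.mk_add_mk, smul_eq_mul]
    congr 1
    ring
  set A := convexJoin ℝ (P s x '' K) (P t y '' K) with hA
  have hAconv : Convex ℝ A := (hPconv s x).convexJoin (hPconv t y)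
  have hAimage : A = (fun q : StrongDual ℝ E × StrongDual ℝ E × ℝ =>
      (1 - q.2.2) • P s x q.1 + q.2.2 • P t y q.2.1) '' (K ×ˢ K ×ˢ Icc (0 : ℝ) 1) := by
    ext p
    rw [hA, mem_convexJoin]
    constructor
    · rintro ⟨_, ⟨u, hu, rfl⟩, _, ⟨v, hv, rfl⟩, hp⟩
      rw [segment_eq_image] at hp
      obtain ⟨θ, hθ, rfl⟩ := hp
      exact ⟨(u, v, θ), ⟨hu, hv, hθ⟩, rfl⟩
    · rintro ⟨⟨u, v, θ⟩, ⟨hu, hv, hθ⟩, rfl⟩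
      refine ⟨_, ⟨u, hu, rfl⟩, _, ⟨v, hv, rfl⟩, ?_⟩
      rw [segment_eq_image]
      exact ⟨θ, hθ, rfl⟩
  have hAcomp : IsCompact A := by
    rw [hAimage]
    refine (h.isCompact_polarAt.prod (h.isCompact_polarAt.prod isCompact_Icc)).image ?_
    have h1 := hPcont s x
    have h2 := hPcont t y
    fun_prop
  have hmemA₁ : ∀ u ∈ K, P s x u ∈ A := fun u hu =>
    subset_convexJoin_left ((show K.Nonempty from ⟨u, hu⟩).image _) (mem_image_of_mem _ hu)
  have hmemA₂ : ∀ u ∈ K, P t y u ∈ A := fun u hu =>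
    subset_convexJoin_right ((show K.Nonempty from ⟨u, hu⟩).image _) (mem_image_of_mem _ hu)
  have hdisj : Disjoint A B := by
    rw [Set.disjoint_left, hAimage]
    rintro _ ⟨⟨u, v, θ⟩, ⟨hu, hv, hθ⟩, rfl⟩ hp
    have h1 := hcomb u hu v hv (1 - θ) θ _ (by linarith [hθ.2]) hθ.1 (by ring) hp
    have h2 : 0 < s * gap o x u := mul_pos hs (h.gap_pos hx hu)
    have h3 : 0 < t * gap o y v := mul_pos ht (h.gap_pos hy hv)
    simp only [P, Prod.smul_snd, smul_eq_mul] at h1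
    have h4 : 0 < (1 - θ) * (s * gap o x u) + θ * (t * gap o y v) := by
      rcases hθ.1.eq_or_lt with h0 | h0
      · have h0 : θ = 0 := h0.symm
        subst h0
        simpa using h2
      · have := mul_nonneg (sub_nonneg.2 hθ.2) h2.le
        have := mul_pos h0 h3
        linarith
    nlinarith
  obtain ⟨f, α, β, hfA, hαβ, hfB⟩ :=
    geometric_hahn_banach_compact_closed hAconv hAcomp hBc hBcl hdisj
  set Ψ : StrongDual ℝ (StrongDual ℝ E) := f.comp (ContinuousLinearMap.inl ℝ _ _) with hΨ
  set c := f (0, 1) with hc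
  have hf : ∀ u τ, f (u, τ) = Ψ u + τ * c := by
    intro u τ
    have h1 : (u, τ) = (u, (0 : ℝ)) + τ • ((0 : StrongDual ℝ E), (1 : ℝ)) := by simp
    rw [h1, map_add, map_smul, smul_eq_mul]
    rfl
  have hcpos : 0 < c := by
    obtain ⟨⟨w, τ⟩, hw⟩ := hBne
    have h1 := hfB _ hw
    have h2 := hfA _ (hmemA₁ w (hBK _ hw))
    have h3 := hcomb w (hBK _ hw) w (hBK _ hw) 1 0 τ zero_le_one le_rfl (by ring)
      (by simpa using hw)
    have h4 : 0 < s * gap o x w := mul_pos hs (h.gap_pos hx (hBK _ hw))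
    simp only [P] at h2
    rw [hf] at h1 h2
    have h5 : (1 - η) * (s * gap o x w) * c < τ * c := by linarith
    have h6 : (1 - η) * (s * gap o x w) < τ := by nlinarith
    exact lt_of_not_ge fun hc0 => absurd h5 (not_lt.2 (mul_le_mul_of_nonpos_right h6.le hc0))
  have hge : ∀ u τ, (u, τ) ∈ A → τ < α / c - (c⁻¹ • Ψ) u := by
    intro u τ hu
    have h1 := hfA _ hu
    rw [hf] at h1
    rw [smul_apply, smul_eq_mul, inv_mul_eq_div, ← sub_div, lt_div_iff₀ hcpos]
    linarith
  obtain ⟨r, hr, z, hz, hrz⟩ := h.exists_mul_gap_eq (c⁻¹ • Ψ) (c := α / c) fun u hu =>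
    (mul_pos hη (mul_pos hs (h.gap_pos hx hu))).trans (hge _ _ (hmemA₁ u hu))
  refine ⟨r, hr, z, hz, ?_, fun u hu => ?_, fun u hu => ?_⟩
  · rintro ⟨w, τ⟩ hw
    have h1 := hfB _ hw
    rw [hf] at h1
    rw [← hrz, smul_apply, smul_eq_mul, inv_mul_eq_div, ← sub_div, div_lt_iff₀ hcpos]
    change α - Ψ w < τ * c
    linarith
  · rw [← hrz]; exact (hge _ _ (hmemA₁ u hu)).le
  · rw [← hrz]; exact (hge _ _ (hmemA₂ u hu)).le

/-- If the positive affine functions below `B` can be joined in pairs below `B`, then finitely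
many of them, multiplied by any factor less than `1`, have a common affine majorant below `B`. -/
theorem exists_gap_ge_finset (h : IsBoundedConvexDomain D o) (hBc : Convex ℝ B) (hBcl : IsClosed B)
    (hBne : B.Nonempty) (hBK : ∀ p ∈ B, p.1 ∈ polarAt D o)
    (hcomb : ∀ x ∈ D, ∀ y ∈ D, ∀ s t : ℝ, 0 < s → 0 < t → (∀ p ∈ B, s * gap o x p.1 ≤ p.2) →
      (∀ p ∈ B, t * gap o y p.1 ≤ p.2) →
      ∀ u ∈ polarAt D o, ∀ v ∈ polarAt D o, ∀ a b c : ℝ, 0 < a → 0 < b → a + b = 1 →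
      (a • u + b • v, c) ∈ B → a * (s * gap o x u) + b * (t * gap o y v) ≤ c)
    {S : Finset D} (hS : S.Nonempty) (s : D → ℝ) (hs : ∀ x ∈ S, 0 < s x)
    (hSB : ∀ x ∈ S, ∀ p ∈ B, s x * gap o x p.1 ≤ p.2) {η : ℝ} (hη0 : 0 < η) (hη1 : η < 1) :
    ∃ r > 0, ∃ z ∈ D, (∀ p ∈ B, r * gap o z p.1 < p.2) ∧
      ∀ x ∈ S, ∀ u ∈ polarAt D o, (1 - η) * (s x * gap o x u) ≤ r * gap o z u := by
  induction hS using Finset.Nonempty.cons_induction generalizing η with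
  | singleton x =>
    have hsx := hs x (Finset.mem_singleton_self x)
    refine ⟨(1 - η) * s x, by nlinarith, x, x.2, fun p hp => ?_, fun y hy u _ => ?_⟩
    · have h1 := hSB x (Finset.mem_singleton_self x) p hp
      have h2 := mul_pos hsx (h.gap_pos x.2 (hBK p hp))
      nlinarith
    · rw [Finset.mem_singleton.1 hy, mul_assoc]
  | cons x S hxS hS ih =>
    obtain ⟨r, hr, z, hz, hrB, hrS⟩ := ih (fun y hy => hs y (Finset.mem_cons_of_mem hy))
      (fun y hy => hSB y (Finset.mem_cons_of_mem hy)) (half_pos hη0) (by linarith)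
    have hx := Finset.mem_cons_self x S (h := hxS)
    obtain ⟨r', hr', z', hz', hrB', h₁, h₂⟩ := h.exists_gap_sandwich hBc hBcl hBne hBK x.2 hz
      (hs x hx) hr (fun u hu v hv a b c ha hb hab huv => by
        rcases ha.eq_or_lt with rfl | ha
        · have hb1 : b = 1 := by linarith
          subst hb1
          simpa using (hrB _ huv).le
        rcases hb.eq_or_lt with rfl | hb
        · have ha1 : a = 1 := by linarith
          subst ha1
          simpa using hSB x hx _ huv
        exact hcomb x x.2 z hz _ _ (hs x hx) hr (hSB x hx) (fun p hp => (hrB p hp).le)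
          u hu v hv a b c ha hb hab huv) (half_pos hη0) (by linarith)
    refine ⟨r', hr', z', hz', hrB', fun y hy u hu => ?_⟩
    have hpos : ∀ y ∈ Finset.cons x S hxS, 0 < s y * gap o y u := fun y hy =>
      mul_pos (hs y hy) (h.gap_pos y.2 hu)
    rcases Finset.mem_cons.1 hy with rfl | hyS
    · have h3 := h₁ u hu
      nlinarith [hpos y hy]
    · have h3 := hrS y hyS u hu
      have h4 := h₂ u hu
      have h5 := hpos y hy
      have h6 : (1 - η / 2) * ((1 - η / 2) * (s y * gap o y u)) ≤ (1 - η / 2) * (r * gap o z u) :=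
        mul_le_mul_of_nonneg_left h3 (by linarith)
      have h7 := mul_nonneg (sq_nonneg η) h5.le
      linarith

end IsBoundedConvexDomain

/-! ### Funk functions along an ultrafilter that leaves the domain -/

theorem IsCompact.exists_tendsto_ultrafilter {X Y : Type*} [TopologicalSpace Y] {s : Set Y}
    (hs : IsCompact s) (U : Ultrafilter X) {v : X → Y} (hv : ∀ x, v x ∈ s) :
    ∃ w ∈ s, Tendsto v U (𝓝 w) :=
  hs.ultrafilter_le_nhds' (U.map v) (show v ⁻¹' s ∈ U from univ_mem' hv)

namespace IsBoundedConvexDomain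

variable {E : Type*} [NormedAddCommGroup E] [NormedSpace ℝ E]
  {D : Set E} {o ξ : E} {b : D}

/-- The affine function of the point `z`, scaled so that it dominates that of the base-point `b` on
the polar, with equality somewhere. -/
noncomputable def scaledGap (D : Set E) (o : E) (b z : D) (u : StrongDual ℝ E) : ℝ :=
  Real.exp (funk o (polarAt D o) b z) * gap o z u

/-- The upper epigraphical limit, along `U`, of the affine functions `scaledGap D o b z` on the
polar. -/
def epiLimit (D : Set E) (o : E) (b : D) (U : Filter D) : Set (StrongDual ℝ E × ℝ) :=
  {p | ∀ ε > 0, ∀ᶠ z in U, ∃ v ∈ polarAt D o, dist v p.1 < ε ∧ scaledGap D o b z v < p.2 + ε}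

theorem scaledGap_comb (b z : D) {u v : StrongDual ℝ E} {s t : ℝ} (hst : s + t = 1) :
    scaledGap D o b z (s • u + t • v) = s * scaledGap D o b z u + t * scaledGap D o b z v := by
  unfold scaledGap
  rw [gap_comb hst]
  ring

theorem convex_epiLimit (U : Filter D) : Convex ℝ (epiLimit D o b U) := by
  intro p hp q hq s t hs ht hst ε hε
  filter_upwards [hp ε hε, hq ε hε] with z ⟨v, hv, hvd, hvz⟩ ⟨w, hw, hwd, hwz⟩
  refine ⟨s • v + t • w, convex_polarAt D o hv hw hs ht hst, ?_, ?_⟩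
  · rw [dist_eq_norm] at *
    have := (convex_ball (0 : StrongDual ℝ E) ε) (mem_ball_zero_iff.2 hvd)
      (mem_ball_zero_iff.2 hwd) hs ht hst
    rw [mem_ball_zero_iff] at this
    convert! this using 2
    simp only [Prod.fst_add, Prod.smul_fst]
    module
  · rw [scaledGap_comb b z hst]
    simp only [Prod.snd_add, Prod.smul_snd, smul_eq_mul]
    have := (convex_Iio ε) (show scaledGap D o b z v - p.2 ∈ Iio ε by simp; linarith)
      (show scaledGap D o b z w - q.2 ∈ Iio ε by simp; linarith) hs ht hst
    simp only [smul_eq_mul, mem_Iio] at this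
    linarith

theorem isClosed_epiLimit (U : Filter D) : IsClosed (epiLimit D o b U) := by
  refine isClosed_of_closure_subset fun p hp ε hε => ?_
  obtain ⟨q, hq, hpq⟩ := Metric.mem_closure_iff.1 hp (ε / 2) (half_pos hε)
  rw [Prod.dist_eq, max_lt_iff, Real.dist_eq, abs_lt] at hpq
  filter_upwards [hq (ε / 2) (half_pos hε)] with z ⟨v, hv, hvd, hvz⟩
  refine ⟨v, hv, ?_, by linarith⟩
  linarith [dist_triangle_right v p.1 q.1]

theorem fst_mem_polarAt_of_mem_epiLimit {U : Filter D} [U.NeBot] :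
    ∀ p ∈ epiLimit D o b U, p.1 ∈ polarAt D o := fun p hp => by
  refine (isClosed_polarAt D o).closure_subset (Metric.mem_closure_iff.2 fun ε hε => ?_)
  obtain ⟨z, v, hv, hvd, -⟩ := (hp ε hε).exists
  exact ⟨v, hv, by rwa [dist_comm]⟩

/-- An affine function that is eventually below the functions `scaledGap D o b z` is below their
epigraphical limit. -/
theorem le_of_mem_epiLimit {U : Filter D} [U.NeBot] {x : D} {s : ℝ}
    (hx : ∀ η > 0, ∀ᶠ z in U, ∀ u ∈ polarAt D o,
      s * gap o x u ≤ Real.exp η * scaledGap D o b z u) :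
    ∀ p ∈ epiLimit D o b U, s * gap o x p.1 ≤ p.2 := by
  intro p hp
  have key : ∀ ε > 0, s * gap o x p.1 ≤ Real.exp ε * (p.2 + ε) + ε := by
    intro ε hε
    have hcont : Continuous fun u => s * gap o x u := continuous_const.mul (continuous_gap o x)
    obtain ⟨δ, hδ, hd⟩ := Metric.continuousAt_iff.1 (hcont.continuousAt (x := p.1)) ε hε
    obtain ⟨z, ⟨v, hv, hvd, hvz⟩, hz⟩ := ((hp (min δ ε) (by positivity)).and (hx ε hε)).exists
    have h1 := hd (hvd.trans_le (min_le_left _ _))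
    rw [Real.dist_eq, abs_lt] at h1
    have h2 : Real.exp ε * scaledGap D o b z v ≤ Real.exp ε * (p.2 + ε) := by
      gcongr
      linarith [min_le_right δ ε]
    linarith [hz v hv]
  have hlim : Tendsto (fun ε : ℝ => Real.exp ε * (p.2 + ε) + ε) (𝓝[>] 0) (𝓝 p.2) := by
    have : Continuous fun ε : ℝ => Real.exp ε * (p.2 + ε) + ε := by fun_prop
    simpa using (this.tendsto 0).mono_left nhdsWithin_le_nhds
  exact ge_of_tendsto hlim (eventually_mem_nhdsWithin.mono fun ε hε => key ε hε)

variable [FiniteDimensional ℝ E]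

theorem tendsto_funk_atTop (h : IsBoundedConvexDomain D o) {ι : Type*} {l : Filter ι} {z : ι → D}
    (hz : Tendsto (fun i => (z i : E)) l (𝓝 ξ)) (hξ : ξ ∉ D) (b : D) :
    Tendsto (fun i => funk o (polarAt D o) b (z i)) l atTop := by
  obtain ⟨u, hu, hle⟩ := h.exists_gap_nonpos hξ
  refine tendsto_atTop.2 fun c => ?_
  have hb := h.gap_pos b.2 hu
  have h1 : gap o ξ u < Real.exp (-c) * gap o b u := hle.trans_lt (by positivity)
  have h2 : Tendsto (fun i => gap o (z i) u) l (𝓝 (gap o ξ u)) :=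
    ((continuous_gap_left o u).tendsto ξ).comp hz
  filter_upwards [h2.eventually (gt_mem_nhds h1)] with i hi
  have h3 := h.gap_le_exp_funk_mul h.isCompact_polarAt ⟨0, zero_mem_polarAt D o⟩ Subset.rfl
    (exists_gap_pos_polarAt D o b) (z i).2 hu
  by_contra! hlt
  have h4 : Real.exp (funk o (polarAt D o) b (z i)) * gap o (z i) u
      ≤ Real.exp c * gap o (z i) u := by
    gcongr
    exact (h.gap_pos (z i).2 hu).le
  have h5 : Real.exp c * gap o (z i) u < Real.exp c * (Real.exp (-c) * gap o b u) := by gcongr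
  rw [← mul_assoc, ← Real.exp_add, add_neg_cancel, Real.exp_zero, one_mul] at h5
  linarith

theorem gap_le_scaledGap (h : IsBoundedConvexDomain D o) (b z : D) {u : StrongDual ℝ E}
    (hu : u ∈ polarAt D o) : gap o b u ≤ scaledGap D o b z u :=
  h.gap_le_exp_funk_mul h.isCompact_polarAt ⟨0, zero_mem_polarAt D o⟩ Subset.rfl
    (exists_gap_pos_polarAt D o b) z.2 hu

/-- Conversely, an affine function strictly below the epigraphical limit along an ultrafilter is
eventually below the functions `scaledGap D o b z`. -/
theorem eventually_le_scaledGap (h : IsBoundedConvexDomain D o) {U : Ultrafilter D} {x : E} {s : ℝ}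
    (hx : ∀ p ∈ epiLimit D o b U, s * gap o x p.1 < p.2) :
    ∀ᶠ z in U, ∀ u ∈ polarAt D o, s * gap o x u ≤ scaledGap D o b z u := by
  by_contra hcon
  rw [← Ultrafilter.eventually_not] at hcon
  have hcont : Continuous fun u => s * gap o x u := continuous_const.mul (continuous_gap o x)
  have hch : ∀ z : D, ∃ u ∈ polarAt D o,
      (¬ ∀ u ∈ polarAt D o, s * gap o x u ≤ scaledGap D o b z u) →
        scaledGap D o b z u < s * gap o x u := by
    intro z
    by_cases hz : ∀ u ∈ polarAt D o, s * gap o x u ≤ scaledGap D o b z u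
    · exact ⟨0, zero_mem_polarAt D o, fun hn => absurd hz hn⟩
    · push Not at hz
      exact hz.imp fun u hu => ⟨hu.1, fun _ => hu.2⟩
  choose v hvK hv using hch
  obtain ⟨w, hwK, hw⟩ := h.isCompact_polarAt.exists_tendsto_ultrafilter U hvK
  have hmem : (w, s * gap o x w) ∈ epiLimit D o b U := by
    intro ε hε
    have h1 : Tendsto (fun z => s * gap o x (v z)) U (𝓝 (s * gap o x w)) :=
      (hcont.tendsto w).comp hw
    filter_upwards [hcon, Metric.tendsto_nhds.1 hw ε hε,
      h1.eventually (gt_mem_nhds (show s * gap o x w < s * gap o x w + ε by linarith))]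
      with z hz hzd hzs
    exact ⟨v z, hvK z, hzd, (hv z hz).trans hzs⟩
  exact lt_irrefl _ (hx _ hmem)

theorem nonempty_epiLimit (h : IsBoundedConvexDomain D o) (U : Ultrafilter D) :
    (epiLimit D o b U).Nonempty := by
  by_contra hne
  rw [not_nonempty_iff_eq_empty] at hne
  obtain ⟨z, hz⟩ := (h.eventually_le_scaledGap (x := b) (s := 2) (b := b) (U := U)
    (by simp [hne])).exists
  have hK : (polarAt D o).Nonempty := ⟨0, zero_mem_polarAt D o⟩
  have h1 := (h.funk_le_iff h.isCompact_polarAt hK Subset.rfl (exists_gap_pos_polarAt D o b) z.2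
    (c := funk o (polarAt D o) b z - Real.log 2)).2 fun u hu => by
      have := hz u hu
      unfold scaledGap at this
      rw [Real.exp_sub, Real.exp_log two_pos, div_mul_eq_mul_div, le_div_iff₀ two_pos]
      linarith
  linarith [Real.log_pos one_lt_two]

/-- Over the epigraphical limit, the affine function of the boundary point `ξ` is nonpositive,
hence zero. -/
theorem gap_nonpos_of_mem_epiLimit (h : IsBoundedConvexDomain D o) {U : Filter D} [U.NeBot]
    (hU : Tendsto ((↑) : D → E) U (𝓝 ξ)) (hξ : ξ ∉ D) :
    ∀ p ∈ epiLimit D o b U, gap o ξ p.1 ≤ 0 := by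
  intro p hp
  by_contra! hpos
  have hcont : Continuous fun q : E × StrongDual ℝ E => gap o q.1 q.2 := by
    unfold gap; fun_prop
  have h1 : ∀ᶠ q : E × StrongDual ℝ E in 𝓝 ξ ×ˢ 𝓝 p.1, gap o ξ p.1 / 2 < gap o q.1 q.2 := by
    rw [← nhds_prod_eq]
    exact (hcont.tendsto (ξ, p.1)).eventually (lt_mem_nhds (half_lt_self hpos))
  obtain ⟨P, hP, Q, hQ, hPQ⟩ := eventually_prod_iff.1 h1
  obtain ⟨δ, hδ, hQδ⟩ := Metric.eventually_nhds_iff.1 hQ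
  have h2 := (h.tendsto_funk_atTop hU hξ b).eventually_ge_atTop
    (Real.log ((|p.2| + 1) / (gap o ξ p.1 / 2)))
  obtain ⟨z, ⟨⟨v, hv, hvd, hvz⟩, hPz⟩, hz⟩ :=
    (((hp (min δ 1) (by positivity)).and (hU.eventually hP)).and h2).exists
  have h3 := hPQ hPz (hQδ (hvd.trans_le (min_le_left _ _)))
  rw [Real.log_le_iff_le_exp (by positivity), div_le_iff₀ (by positivity)] at hz
  have h4 : Real.exp (funk o (polarAt D o) b z) * (gap o ξ p.1 / 2) ≤ scaledGap D o b z v := by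
    unfold scaledGap
    gcongr
  linarith [le_abs_self p.2, min_le_right δ 1]

/-- When the polar is stable, the epigraphical limit is also concave in the sense needed to find
affine functions below it. -/
theorem comb_le_of_mem_epiLimit (h : IsBoundedConvexDomain D o) {U : Ultrafilter D}
    (hlim : ∀ (C : ℕ → Closeds (StrongDual ℝ E)) (L : Closeds (StrongDual ℝ E)),
      (∀ n, C n ∈ extremeSets (polarAt D o)) → PKTendsto C L → L ∈ extremeSets (polarAt D o))
    {x y : E} (hx : x ∈ D) (hy : y ∈ D) {s t : ℝ} (hs : 0 < s) (ht : 0 < t)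
    (hsB : ∀ p ∈ epiLimit D o b U, s * gap o x p.1 ≤ p.2)
    (htB : ∀ p ∈ epiLimit D o b U, t * gap o y p.1 ≤ p.2)
    {u v : StrongDual ℝ E} (hu : u ∈ polarAt D o) (hv : v ∈ polarAt D o) {α β c : ℝ}
    (hα : 0 < α) (hβ : 0 < β) (hαβ : α + β = 1) (hmem : (α • u + β • v, c) ∈ epiLimit D o b U) :
    α * (s * gap o x u) + β * (t * gap o y v) ≤ c := by
  set S := α * (s * gap o x u) + β * (t * gap o y v) with hS
  have hev : ∀ {x : E} {s : ℝ}, x ∈ D → 0 < s → (∀ p ∈ epiLimit D o b U, s * gap o x p.1 ≤ p.2) →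
      ∀ η, 0 < η → ∀ᶠ z in U, ∀ u ∈ polarAt D o,
        (1 - η) * s * gap o x u ≤ scaledGap D o b z u := by
    intro x s hx hs hB η hη
    refine h.eventually_le_scaledGap fun p hp => ?_
    have h1 := mul_pos hs (h.gap_pos hx (fst_mem_polarAt_of_mem_epiLimit p hp))
    have h2 := hB p hp
    rw [mul_assoc]
    nlinarith
  have key : ∀ ε ∈ Ioo (0 : ℝ) 1, (1 - ε) * (S - ε) - ε ≤ c := by
    rintro ε ⟨hε0, hε1⟩
    have hcx : Continuous fun u => s * gap o x u := continuous_const.mul (continuous_gap o x)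
    have hcy : Continuous fun u => t * gap o y u := continuous_const.mul (continuous_gap o y)
    obtain ⟨δ₁, hδ₁, hd₁⟩ := Metric.continuousAt_iff.1 (hcx.continuousAt (x := u)) ε hε0
    obtain ⟨δ₂, hδ₂, hd₂⟩ := Metric.continuousAt_iff.1 (hcy.continuousAt (x := v)) ε hε0
    obtain ⟨δ, hδ, hsplit⟩ := exists_splitsNear (convex_polarAt D o) h.isCompact_polarAt hlim
      hu hv hα hβ hαβ (lt_min hδ₁ hδ₂)
    obtain ⟨z, ⟨⟨w, hw, hwd, hwz⟩, hz₁⟩, hz₂⟩ :=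
      (((hmem (min δ ε) (by positivity)).and (hev hx hs hsB ε hε0)).and
        (hev hy ht htB ε hε0)).exists
    obtain ⟨u', hu', v', hv', rfl, hdu, hdv⟩ := hsplit w hw (hwd.trans_le (min_le_left _ _))
    have h1 := hd₁ (hdu.trans_le (min_le_left _ _))
    have h2 := hd₂ (hdv.trans_le (min_le_right _ _))
    rw [Real.dist_eq, abs_lt] at h1 h2
    rw [scaledGap_comb b z hαβ] at hwz
    have h3 := hz₁ u' hu'
    have h4 := hz₂ v' hv'
    have h5 : (1 - ε) * (s * gap o x u - ε) ≤ scaledGap D o b z u' :=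
      le_trans (by rw [mul_assoc]; gcongr; linarith) h3
    have h6 : (1 - ε) * (t * gap o y v - ε) ≤ scaledGap D o b z v' :=
      le_trans (by rw [mul_assoc]; gcongr; linarith) h4
    have h7 := mul_le_mul_of_nonneg_left h5 hα.le
    have h8 := mul_le_mul_of_nonneg_left h6 hβ.le
    have h9 : (1 - ε) * (S - ε) = α * ((1 - ε) * (s * gap o x u - ε))
        + β * ((1 - ε) * (t * gap o y v - ε)) := by
      rw [hS, show β = 1 - α by linarith]; ring
    simp only at hwz
    linarith [min_le_right δ ε]
  have hl : Tendsto (fun ε : ℝ => (1 - ε) * (S - ε) - ε) (𝓝[>] 0) (𝓝 S) := by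
    have : Continuous fun ε : ℝ => (1 - ε) * (S - ε) - ε := by fun_prop
    simpa using (this.tendsto 0).mono_left nhdsWithin_le_nhds
  refine le_of_tendsto hl ?_
  filter_upwards [Ioo_mem_nhdsGT (one_pos (α := ℝ))] with ε hε using key ε hε

end IsBoundedConvexDomain

/-! ### Horofunctions are Busemann points when the polar is stable -/

namespace IsBoundedConvexDomain

variable {E : Type*} [NormedAddCommGroup E] [NormedSpace ℝ E] [FiniteDimensional ℝ E]
  {D : Set E} {o ξ : E} {b : D}

theorem distFun_hilbertDist_eq (h : IsBoundedConvexDomain D o) (b z x : D) :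
    distFun (hilbertDist D) b z x =
      (funk o (polarAt D o) x z - funk o (polarAt D o) b z) +
        (funk o (polarAt D o) z x - funk o (polarAt D o) z b) := by
  simp only [distFun, h.hilbertDist_eq]
  ring

/-- Towards a point `ξ` of the closure of the domain, convergence of the functions `ψ_z` is that of
their Funk parts. -/
theorem tendsto_distFun_iff (h : IsBoundedConvexDomain D o) {ι : Type*} {l : Filter ι} {z : ι → D}
    (hz : Tendsto (fun i => (z i : E)) l (𝓝 ξ)) (x : D) (c : ℝ) :
    Tendsto (fun i => distFun (hilbertDist D) b (z i) x) l
        (𝓝 (c + (funk o (polarAt D o) ξ x - funk o (polarAt D o) ξ b))) ↔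
      Tendsto (fun i => funk o (polarAt D o) x (z i) - funk o (polarAt D o) b (z i)) l (𝓝 c) := by
  have h1 : ∀ x : D, Tendsto (fun i => funk o (polarAt D o) (z i) x) l
      (𝓝 (funk o (polarAt D o) ξ x)) := fun x =>
    ((h.continuous_funk_left x.2).tendsto ξ).comp hz
  have h2 := (h1 x).sub (h1 b)
  simp only [h.distFun_hilbertDist_eq]
  constructor
  · intro h3
    simpa using h3.sub h2
  · exact fun h3 => h3.add h2

/-- If the faces of the polar form a closed family, a horofunction is a Busemann point. Its Funk part
is described by the epigraphical limit; affine functions below that limit which dominate more and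
more of the functions `exp (-g x) * gap o x`, with a large multiple of the affine function of the
limit point `ξ` added, are the points of a sequence which has an almost-geodesic subsequence. -/
theorem isBusemannPoint_of_mem_horofunctions (h : IsBoundedConvexDomain D o)
    (hlim : ∀ (C : ℕ → Closeds (StrongDual ℝ E)) (L : Closeds (StrongDual ℝ E)),
      (∀ n, C n ∈ extremeSets (polarAt D o)) → PKTendsto C L → L ∈ extremeSets (polarAt D o))
    {f : D → ℝ} (hf : f ∈ horofunctions (hilbertDist D) b) :
    IsBusemannPoint (hilbertDist D) b f := by
  refine ⟨hf, ?_⟩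
  obtain ⟨-, hcl, hrange⟩ := hf
  set K := polarAt D o with hK
  have hKne : K.Nonempty := ⟨0, zero_mem_polarAt D o⟩
  -- an ultrafilter of points `z` with `ψ_z → f`
  let Ψ : D → UniformOnFun D ℝ (symBoundedSets (hilbertDist D)) :=
    fun z => asUniformOnBounded (hilbertDist D) (distFun (hilbertDist D) b z)
  have hne : (comap Ψ (𝓝 (asUniformOnBounded (hilbertDist D) f))).NeBot := by
    refine comap_neBot_iff.2 fun t ht => ?_
    obtain ⟨_, hmem, z, rfl⟩ := mem_closure_iff_nhds.1 hcl t ht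
    exact ⟨z, hmem⟩
  let U := Ultrafilter.of (comap Ψ (𝓝 (asUniformOnBounded (hilbertDist D) f)))
  have hUlim : Tendsto Ψ U (𝓝 (asUniformOnBounded (hilbertDist D) f)) :=
    tendsto_comap.mono_left (Ultrafilter.of_le _)
  have hpt : ∀ x, Tendsto (fun z => distFun (hilbertDist D) b z x) U (𝓝 (f x)) :=
    asUniformOnBounded_apply_tendsto hilbertDist_self hUlim
  have hflip : ∀ x y, |f x - f y| ≤ hilbertDist D x y := fun x y =>
    le_of_tendsto ((hpt x).sub (hpt y)).abs
      (Eventually.of_forall fun z => h.abs_distFun_sub_le b z x y)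
  obtain ⟨ξ, hξcl, hξ⟩ := h.isCompact_closure.exists_tendsto_ultrafilter U
    (v := ((↑) : D → E)) fun z => subset_closure z.2
  have hξD : ξ ∉ D := by
    intro hD
    refine hrange ⟨⟨ξ, hD⟩, funext fun x => tendsto_nhds_unique ?_ (hpt x)⟩
    have hU : Tendsto id (U : Filter D) (𝓝 ⟨ξ, hD⟩) := by
      rw [tendsto_subtype_rng]; exact hξ
    have hd : Tendsto (fun z : D => hilbertDist D ⟨ξ, hD⟩ z) U (𝓝 0) :=
      (h.tendsto_hilbertDist ⟨ξ, hD⟩).comp hU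
    rw [tendsto_iff_dist_tendsto_zero]
    refine squeeze_zero (fun _ => dist_nonneg) (fun z => ?_) (by simpa using hd.add hd)
    rw [Real.dist_eq, abs_le]
    unfold distFun
    have h1 := h.hilbertDist_triangle x ⟨ξ, hD⟩ z
    have h2 := h.hilbertDist_triangle b ⟨ξ, hD⟩ z
    have h3 := h.hilbertDist_triangle x z ⟨ξ, hD⟩
    have h4 := h.hilbertDist_triangle b z ⟨ξ, hD⟩
    rw [h.hilbertDist_comm z] at h3 h4
    constructor <;> linarith
  -- the Funk part of `f`
  let g : D → ℝ := fun x => f x - (funk o K ξ x - funk o K ξ b)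
  have hg : ∀ x : D, Tendsto (fun z : D => funk o K x z - funk o K b z) U (𝓝 (g x)) := fun x =>
    (h.tendsto_distFun_iff hξ x (g x)).1 (by simpa [g, hK] using hpt x)
  have hgb : g b = 0 := tendsto_nhds_unique (hg b) (by simp)
  have hgtri : ∀ x y : D, g x ≤ funk o K x y + g y := fun x y =>
    le_of_tendsto_of_tendsto (hg x) ((hg y).const_add _) (Eventually.of_forall fun z => by
      have := h.funk_triangle' x y.2 z.2
      simp only
      linarith)
  set B := epiLimit D o b U with hB
  have hbelow : ∀ x : D, ∀ p ∈ B, Real.exp (-g x) * gap o x p.1 ≤ p.2 := by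
    intro x
    refine le_of_mem_epiLimit fun η hη => ?_
    filter_upwards [(hg x).eventually (gt_mem_nhds (lt_add_of_pos_right (g x) hη))] with z hz u hu
    rw [Real.exp_neg, inv_mul_le_iff₀ (Real.exp_pos _), scaledGap, ← mul_assoc, ← mul_assoc,
      ← Real.exp_add, ← Real.exp_add]
    exact (h.funk_le_iff h.isCompact_polarAt hKne Subset.rfl (exists_gap_pos_polarAt D o x) z.2).1
      (by linarith) u hu
  have hg_le : ∀ (x : D) (r : ℝ), 0 < r → (∀ p ∈ B, r * gap o x p.1 < p.2) →
      g x ≤ -Real.log r := by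
    intro x r hr hxB
    refine le_of_tendsto (hg x) ?_
    filter_upwards [h.eventually_le_scaledGap hxB] with z hz
    have := h.funk_le_sub_log h.isCompact_polarAt hKne Subset.rfl (exists_gap_pos_polarAt D o x)
      z.2 hr hz
    linarith
  -- the approximating sequence
  have : ProperSpace E := FiniteDimensional.proper ℝ E
  have : Nonempty D := ⟨b⟩
  let e := denseSeq D
  classical
  let S : ℕ → Finset D := fun k => insert b ((Finset.range (k + 1)).image e)
  let θ : ℕ → ℝ := fun k => 1 - 1 / ((k : ℝ) + 2)
  have hθ : ∀ k, 0 < θ k ∧ θ k < 1 := fun k => by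
    have h1 : (0 : ℝ) < 1 / ((k : ℝ) + 2) := by positivity
    have h2 : 1 / ((k : ℝ) + 2) < 1 := by
      rw [div_lt_one (by positivity)]; linarith [k.cast_nonneg (α := ℝ)]
    exact ⟨by simp only [θ]; linarith, by simp only [θ]; linarith⟩
  have hex : ∀ k : ℕ, ∃ (x : D) (y : D) (c : ℝ), (x : E) = (1 - θ k) • (y : E) + θ k • ξ ∧
      g x + c ≤ 0 ∧ (∀ s ∈ S k, funk o K s x ≤ g s + c - Real.log (θ k)) ∧
      funk o K ξ x ≤ -Real.log (θ k) := by
    intro k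
    obtain ⟨hθ0, hθ1⟩ := hθ k
    have hη0 : 0 < 1 - θ k := by linarith
    obtain ⟨r, hr, y, hy, hrB, hrS⟩ := h.exists_gap_ge_finset (B := B)
      (convex_epiLimit _) (isClosed_epiLimit _) (h.nonempty_epiLimit U)
      fst_mem_polarAt_of_mem_epiLimit
      (fun x hx y hy s t hs ht hsB htB u hu v hv α β c hα hβ hαβ huv =>
        h.comb_le_of_mem_epiLimit hlim hx hy hs ht hsB htB hu hv hα hβ hαβ huv)
      (S := S k) (Finset.insert_nonempty _ _) (fun x => Real.exp (-g x))
      (fun x _ => Real.exp_pos _) (fun x _ => hbelow x) hη0 (by linarith)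
    rw [sub_sub_cancel] at hrS
    have hgap : ∀ u, gap o ((1 - θ k) • y + θ k • ξ) u
        = (1 - θ k) * gap o y u + θ k * gap o ξ u := fun u => gap_comb_left (by ring)
    have hpos : ∀ u ∈ K, 0 < (1 - θ k) * gap o y u := fun u hu => mul_pos hη0 (h.gap_pos hy hu)
    have hnn : ∀ u ∈ K, 0 ≤ θ k * gap o ξ u := fun u hu =>
      mul_nonneg hθ0.le (gap_nonneg_of_mem_closure hξcl hu)
    have hxD : (1 - θ k) • y + θ k • ξ ∈ D := h.mem_of_gap_pos fun u hu => by
      rw [hgap]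
      linarith [hpos u hu, hnn u hu]
    refine ⟨⟨_, hxD⟩, ⟨y, hy⟩, Real.log (r / (1 - θ k)), rfl, ?_, ?_, ?_⟩
    · have := hg_le ⟨_, hxD⟩ (r / (1 - θ k)) (by positivity) fun p hp => by
        change r / (1 - θ k) * gap o ((1 - θ k) • y + θ k • ξ) p.1 < p.2
        rw [hgap, mul_add, ← mul_assoc, div_mul_cancel₀ _ hη0.ne']
        have h1 := h.gap_nonpos_of_mem_epiLimit hξ hξD p hp
        have h2 : r / (1 - θ k) * (θ k * gap o ξ p.1) ≤ 0 :=
          mul_nonpos_of_nonneg_of_nonpos (by positivity)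
            (mul_nonpos_of_nonneg_of_nonpos hθ0.le h1)
        linarith [hrB p hp]
      linarith
    · intro s hs
      have := h.funk_le_sub_log h.isCompact_polarAt hKne Subset.rfl
        (exists_gap_pos_polarAt D o s) hxD (r := θ k * Real.exp (-g s)) (by positivity)
        (c := Real.log (r / (1 - θ k))) fun u hu => by
          rw [Real.exp_log (by positivity), hgap, mul_add, ← mul_assoc (r / (1 - θ k)),
            div_mul_cancel₀ _ hη0.ne', mul_assoc]
          have h1 := hrS s hs u hu
          have h2 := mul_nonneg (show 0 ≤ r / (1 - θ k) by positivity) (hnn u hu)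
          linarith
      rw [Real.log_mul hθ0.ne' (Real.exp_pos _).ne', Real.log_exp] at this
      change funk o K s ((1 - θ k) • y + θ k • ξ) ≤ _
      linarith
    · have := h.funk_le_sub_log h.isCompact_polarAt hKne Subset.rfl
        (exists_gap_pos_polarAt D o ξ) hxD hθ0 (c := 0) fun u hu => by
          rw [Real.exp_zero, one_mul, hgap]
          linarith [hpos u hu]
      simpa using this
  choose x y c hxy hgc hS hξx using hex
  have hθlim : Tendsto θ atTop (𝓝 1) := by
    have h1 : Tendsto (fun k : ℕ => 1 / ((k : ℝ) + 2)) atTop (𝓝 0) :=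
      tendsto_const_nhds.div_atTop (tendsto_natCast_atTop_atTop.atTop_add tendsto_const_nhds)
    simpa [θ] using h1.const_sub 1
  have hlog : Tendsto (fun k => Real.log (θ k)) atTop (𝓝 0) := by
    simpa using hθlim.log one_ne_zero
  have hxξ : Tendsto (fun k => (x k : E)) atTop (𝓝 ξ) := by
    obtain ⟨R, hR0, hR⟩ := h.isBounded.exists_pos_norm_le
    rw [tendsto_iff_norm_sub_tendsto_zero]
    have h1 : Tendsto (fun k => (1 - θ k) * (R + ‖ξ‖)) atTop (𝓝 0) := by
      simpa using (hθlim.const_sub 1).mul_const (R + ‖ξ‖)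
    refine squeeze_zero (fun _ => norm_nonneg _) (fun k => ?_) h1
    have h2 : (x k : E) - ξ = (1 - θ k) • ((y k : E) - ξ) := by rw [hxy]; module
    rw [h2, norm_smul, Real.norm_of_nonneg (by linarith [hθ k])]
    gcongr
    · linarith [hθ k]
    · exact (norm_sub_le _ _).trans (by gcongr; exact hR _ (y k).2)
  have hbS : ∀ k, b ∈ S k := fun k => Finset.mem_insert_self _ _
  have hFb : Tendsto (fun k => funk o K b (x k) - c k) atTop (𝓝 0) := by
    refine squeeze_zero' (Eventually.of_forall fun k => ?_) (Eventually.of_forall fun k => ?_)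
      (by simpa using hlog.neg)
    · linarith [hgtri b (x k), hgc k]
    · linarith [hS k b (hbS k)]
  have hFe : ∀ s ∈ range e, Tendsto (fun k => funk o K s (x k) - c k) atTop (𝓝 (g s)) := by
    rintro _ ⟨j, rfl⟩
    have h1 : Tendsto (fun k => g (e j) - Real.log (θ k)) atTop (𝓝 (g (e j))) := by
      simpa using hlog.const_sub (g (e j))
    refine tendsto_of_tendsto_of_tendsto_of_le_of_le' tendsto_const_nhds h1
      (Eventually.of_forall fun k => ?_) ?_
    · linarith [hgtri (e j) (x k), hgc k]
    · filter_upwards [eventually_ge_atTop j] with k hk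
      have := hS k (e j) (Finset.mem_insert_of_mem
        (Finset.mem_image_of_mem _ (Finset.mem_range.2 (by omega))))
      linarith
  refine exists_isAlmostGeodesic hilbertDist_self (x := x) ?_ ?_ ?_
  · refine h.tendsto_asUniformOnBounded (fun k => h.abs_distFun_sub_le b (x k)) hflip
      (denseRange_denseSeq D) fun s hs => ?_
    have h1 := (h.tendsto_distFun_iff (b := b) hxξ s (g s)).2 (by simpa using (hFe s hs).sub hFb)
    simpa [g, hK] using h1
  · refine tendsto_atTop_mono (fun k => ?_) (h.tendsto_funk_atTop hxξ hξD b)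
    rw [h.hilbertDist_eq]
    linarith [h.funk_nonneg (x := (x k : E)) b.2]
  · have h1 : Tendsto (fun k => funk o K b (x k) + g (x k)) atTop (𝓝 0) := by
      refine squeeze_zero (fun k => ?_) (fun k => ?_) (by simpa using hlog.neg)
      · linarith [hgtri b (x k)]
      · linarith [hS k b (hbS k), hgc k]
    have h2 : Tendsto (fun k => funk o K (x k) b + funk o K ξ (x k) - funk o K ξ b) atTop
        (𝓝 0) := by
      have h3 : Tendsto (fun k => funk o K (x k) b - funk o K ξ b - Real.log (θ k)) atTop (𝓝 0) := by
        simpa [hK] using ((((h.continuous_funk_left b.2).tendsto ξ).comp hxξ).sub_const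
          (funk o K ξ b)).sub hlog
      refine squeeze_zero (fun k => ?_) (fun k => ?_) h3
      · linarith [h.funk_triangle' ξ (x k).2 b.2]
      · linarith [hξx k]
    refine (by simpa using h1.add h2 : Tendsto _ atTop (𝓝 (0 : ℝ))).congr fun k => ?_
    rw [h.hilbertDist_eq]
    simp only [g]
    ring

end IsBoundedConvexDomain

/-! ### Limits of faces -/

namespace IsBoundedConvexDomain

variable {E : Type*} [NormedAddCommGroup E] [NormedSpace ℝ E] [FiniteDimensional ℝ E]
  {D : Set E} {o ξ : E} {b : D}

/-- For a face `T` of the polar, the function `x ↦ funk o T x b` is a limit of Funk parts of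
functions `ψ_z`. -/
theorem exists_abs_funk_sub_le (h : IsBoundedConvexDomain D o) (b : D)
    {T : Closeds (StrongDual ℝ E)} (hT : T ∈ extremeSets (polarAt D o))
    (hne : (T : Set (StrongDual ℝ E)).Nonempty) (S : Finset D) {η : ℝ} (hη0 : 0 < η)
    (hη1 : η < 1) :
    ∃ z : D, ∀ x ∈ S, |funk o (polarAt D o) x z - funk o (polarAt D o) b z - funk o T x b|
      ≤ -Real.log (1 - η) := by
  classical
  obtain ⟨hconv, hext⟩ := hT
  have hTc : IsCompact (T : Set (StrongDual ℝ E)) :=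
    h.isCompact_polarAt.of_isClosed_subset T.isClosed hext.subset
  have hK : (polarAt D o).Nonempty := ⟨0, zero_mem_polarAt D o⟩
  let B : Set (StrongDual ℝ E × ℝ) := {p | p.1 ∈ T ∧ gap o b p.1 ≤ p.2}
  have hBcl : IsClosed B := (T.isClosed.preimage continuous_fst).inter
    (isClosed_le ((continuous_gap o b).comp continuous_fst) continuous_snd)
  have hBconv : Convex ℝ B := by
    rintro p ⟨hp, hp'⟩ q ⟨hq, hq'⟩ s t hs ht hst
    refine ⟨hconv hp hq hs ht hst, ?_⟩
    simp only [Prod.fst_add, Prod.smul_fst, Prod.snd_add, Prod.smul_snd, smul_eq_mul, gap_comb hst]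
    gcongr
  have hpos : ∀ x : D, ∃ u ∈ (T : Set (StrongDual ℝ E)), 0 < gap o x u := fun x =>
    h.exists_gap_pos hne hext.subset x.2
  have hBne : B.Nonempty := by
    obtain ⟨w, hw⟩ := hne
    exact ⟨(w, gap o b w), hw, le_rfl⟩
  obtain ⟨r, hr, z, hz, hrB, hrS⟩ := h.exists_gap_ge_finset hBconv hBcl hBne
    (fun p hp => hext.subset hp.1)
    (fun x _ y _ s t _ _ hsB htB u hu v hv α β c hα hβ hαβ huv => by
      have huT := hext.left_mem_of_mem_openSegment hu hv huv.1 ⟨α, β, hα, hβ, hαβ, rfl⟩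
      have hvT := hext.right_mem_of_mem_openSegment hu hv huv.1 ⟨α, β, hα, hβ, hαβ, rfl⟩
      have h1 := mul_le_mul_of_nonneg_left (hsB (u, gap o b u) ⟨huT, le_rfl⟩) hα.le
      have h2 := mul_le_mul_of_nonneg_left (htB (v, gap o b v) ⟨hvT, le_rfl⟩) hβ.le
      have h3 : α * gap o b u + β * gap o b v ≤ c := by
        rw [← gap_comb hαβ]; exact huv.2
      exact (add_le_add h1 h2).trans h3)
    (S := insert b S) (Finset.insert_nonempty _ _) (fun x => Real.exp (-funk o T x b))
    (fun x _ => Real.exp_pos _)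
    (fun x _ p hp => by
      rw [Real.exp_neg, inv_mul_le_iff₀ (Real.exp_pos _)]
      refine (h.gap_le_exp_funk_mul hTc hne hext.subset (hpos x) b.2 hp.1).trans ?_
      gcongr
      exact hp.2) hη0 hη1
  have hupper : ∀ x ∈ insert b S,
      funk o (polarAt D o) x z ≤ Real.log r + funk o T x b - Real.log (1 - η) := by
    intro x hx
    have hη : 0 < 1 - η := by linarith
    have := h.funk_le_sub_log h.isCompact_polarAt hK Subset.rfl (exists_gap_pos_polarAt D o x) hz
      (r := (1 - η) * Real.exp (-funk o T x b)) (by positivity) (c := Real.log r) fun u hu => by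
        rw [Real.exp_log hr, mul_assoc]
        exact hrS x hx u hu
    rw [Real.log_mul hη.ne' (Real.exp_pos _).ne', Real.log_exp] at this
    linarith
  have hlower : ∀ x : D, Real.log r + funk o T x b ≤ funk o (polarAt D o) x z := by
    intro x
    have h1 := h.funk_triangle hTc hne hext.subset (hpos x) hz b.2
    have h2 := h.funk_le_sub_log hTc hne hext.subset (h.exists_gap_pos hne hext.subset hz) b.2 hr
      (c := 0) fun u hu => by
        rw [Real.exp_zero, one_mul]
        exact (hrB (u, gap o b u) ⟨hu, le_rfl⟩).le
    linarith
  have hself := h.funk_self hTc hne hext.subset b.2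
  refine ⟨⟨z, hz⟩, fun x hx => ?_⟩
  have h1 := hupper x (Finset.mem_insert_of_mem hx)
  have h2 := hupper b (Finset.mem_insert_self b S)
  have h3 := hlower x
  have h4 := hlower b
  rw [hself] at h2 h4
  rw [abs_le]
  constructor <;> linarith

theorem tendsto_funk_of_pkTendsto (h : IsBoundedConvexDomain D o)
    {C : ℕ → Closeds (StrongDual ℝ E)} {L : Closeds (StrongDual ℝ E)} (hCL : PKTendsto C L)
    (hCK : ∀ n, (C n : Set (StrongDual ℝ E)) ⊆ polarAt D o)
    (hLK : (L : Set (StrongDual ℝ E)) ⊆ polarAt D o) (hne : (L : Set (StrongDual ℝ E)).Nonempty)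
    (x b : D) : Tendsto (fun n => funk o (C n) x b) atTop (𝓝 (funk o L x b)) := by
  have hcomp : ∀ {A : Closeds (StrongDual ℝ E)}, (A : Set (StrongDual ℝ E)) ⊆ polarAt D o →
      IsCompact (A : Set (StrongDual ℝ E)) := fun {A} hA =>
    h.isCompact_polarAt.of_isClosed_subset A.isClosed hA
  have hev : ∀ᶠ n in atTop, (C n : Set (StrongDual ℝ E)).Nonempty := by
    obtain ⟨u, hu⟩ := hne
    filter_upwards [hCL.eventually_exists_dist_lt hu one_pos] with n hn
    exact hn.imp fun v hv => hv.1
  refine tendsto_order.2 ⟨fun c hc => ?_, fun c hc => ?_⟩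
  · have h1 : ∃ u ∈ (L : Set (StrongDual ℝ E)), Real.exp c * gap o b u < gap o x u := by
      by_contra! hcon
      exact absurd ((h.funk_le_iff (hcomp hLK) hne hLK (h.exists_gap_pos hne hLK x.2) b.2).2 hcon)
        (not_le.2 hc)
    obtain ⟨u, hu, hlt⟩ := h1
    have hopen : IsOpen {u | Real.exp c * gap o b u < gap o x u} :=
      isOpen_lt (continuous_const.mul (continuous_gap o b)) (continuous_gap o x)
    obtain ⟨ε, hε, hball⟩ := Metric.isOpen_iff.1 hopen u hlt
    filter_upwards [hCL.eventually_exists_dist_lt hu hε] with n ⟨v, hv, hvd⟩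
    have hnen : (C n : Set (StrongDual ℝ E)).Nonempty := ⟨v, hv⟩
    by_contra! hle
    exact absurd ((h.funk_le_iff (hcomp (hCK n)) hnen (hCK n)
      (h.exists_gap_pos hnen (hCK n) x.2) b.2).1 hle v hv) (not_le.2 (hball hvd))
  · obtain ⟨c', hc', hcc'⟩ := exists_between hc
    by_contra hcon
    obtain ⟨φ, hφ, hφc⟩ := extraction_of_frequently_atTop
      ((not_eventually.1 hcon).and_eventually hev)
    have hu : ∀ n, ∃ u ∈ (C (φ n) : Set (StrongDual ℝ E)),
        Real.exp c' * gap o b u < gap o x u := by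
      intro n
      obtain ⟨h1, h2⟩ := hφc n
      by_contra! hle
      exact h1 (((h.funk_le_iff (hcomp (hCK _)) h2 (hCK _)
        (h.exists_gap_pos h2 (hCK _) x.2) b.2).2 hle).trans_lt hcc')
    choose u huC hu using hu
    obtain ⟨w, hwK, ψ, hψ, hw⟩ := h.isCompact_polarAt.tendsto_subseq fun n => hCK _ (huC n)
    have hwL : w ∈ (L : Set (StrongDual ℝ E)) := hCL.mem_of_frequently fun ε hε =>
      (hφ.comp hψ).tendsto_atTop.frequently
        ((Metric.tendsto_nhds.1 hw ε hε).mono fun n hn => ⟨_, huC _, hn⟩).frequently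
    have hle : Real.exp c' * gap o b w ≤ gap o x w :=
      le_of_tendsto_of_tendsto
        (((continuous_const.mul (continuous_gap o b)).tendsto w).comp hw)
        (((continuous_gap o x).tendsto w).comp hw) (Eventually.of_forall fun n => (hu _).le)
    have h1 := h.gap_le_exp_funk_mul (hcomp hLK) hne hLK (h.exists_gap_pos hne hLK x.2) b.2 hwL
    have h2 : Real.exp (funk o L x b) * gap o b w < Real.exp c' * gap o b w :=
      mul_lt_mul_of_pos_right (Real.exp_lt_exp.2 hc') (h.gap_pos b.2 hwK)
    linarith

/-- A convex set `T` is a face of the polar if the function with Funk part `x ↦ funk o T x b` is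
approached in the way Busemann points are. Along `l`, the Funk parts then converge separately and the
scaled affine functions of the points asymptotically dominate every affine function that is at most
`gap o b` on `T`, while being at most `gap o b` on `T` themselves. If a segment with an end outside
`T` met `T` in its interior, an affine function large at that end would contradict this. -/
theorem isExtreme_of_tendsto (h : IsBoundedConvexDomain D o) {T : Set (StrongDual ℝ E)}
    (hT : IsCompact T) (hconv : Convex ℝ T) (hne : T.Nonempty) (hTK : T ⊆ polarAt D o) (ξ : E)
    {l : Filter D} [l.NeBot]
    (hlim : ∀ x, Tendsto (fun z => distFun (hilbertDist D) b z x) l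
      (𝓝 (funk o T x b + (funk o (polarAt D o) ξ x - funk o (polarAt D o) ξ b))))
    (hasymp : Tendsto (fun z : D => hilbertDist D b z +
      (funk o T z b + (funk o (polarAt D o) ξ z - funk o (polarAt D o) ξ b))) l (𝓝 0)) :
    IsExtreme ℝ (polarAt D o) T := by
  set K := polarAt D o with hK
  have hpos : ∀ x : D, ∃ u ∈ T, 0 < gap o x u := fun x => h.exists_gap_pos hne hTK x.2
  have htri : ∀ x z : D, funk o T x b ≤ funk o K x z + funk o T z b := fun x z =>
    h.funk_triangle hT hne hTK (hpos x) z.2 b.2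
  have hself : funk o T b b = 0 := h.funk_self hT hne hTK b.2
  have hasymp' : Tendsto (fun z : D => (funk o K b z + funk o T z b) +
      (funk o K z b + funk o K ξ z - funk o K ξ b)) l (𝓝 0) :=
    hasymp.congr fun z => by rw [h.hilbertDist_eq]; ring
  have hA : Tendsto (fun z : D => funk o K b z + funk o T z b) l (𝓝 0) :=
    squeeze_zero (fun z => by linarith [htri b z])
      (fun z => by linarith [h.funk_triangle' ξ z.2 b.2]) hasymp'
  have hB : Tendsto (fun z : D => funk o K z b + funk o K ξ z - funk o K ξ b) l (𝓝 0) :=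
    squeeze_zero (fun z => by linarith [h.funk_triangle' ξ z.2 b.2])
      (fun z => by linarith [htri b z]) hasymp'
  have hFunk : ∀ x : D, Tendsto (fun z : D => funk o K x z - funk o K b z) l
      (𝓝 (funk o T x b)) := by
    intro x
    have h1 : Tendsto (fun z : D => funk o T x b - (funk o K b z + funk o T z b)) l
        (𝓝 (funk o T x b)) := by simpa using hA.const_sub (funk o T x b)
    have h2 : Tendsto (fun z : D => distFun (hilbertDist D) b z x
        - (funk o K ξ x - funk o K ξ b) + (funk o K z b + funk o K ξ z - funk o K ξ b)) l
        (𝓝 (funk o T x b)) := by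
      simpa using ((hlim x).sub_const (funk o K ξ x - funk o K ξ b)).add hB
    refine tendsto_of_tendsto_of_tendsto_of_le_of_le h1 h2 (fun z => ?_) (fun z => ?_)
    · linarith [htri x z]
    · simp only [h.distFun_hilbertDist_eq]
      linarith [h.funk_triangle' ξ z.2 x.2]
  refine ⟨hTK, ?_⟩
  rintro u hu v hv w hw ⟨α, β, hα, hβ, hαβ, rfl⟩
  by_contra huT
  -- `r * gap o x` is at most `gap o b` on `T`, but not at `u`
  obtain ⟨r, hr, x, hx, hxT, hxu⟩ : ∃ r > 0, ∃ x ∈ D, (∀ w ∈ T, r * gap o x w ≤ gap o b w) ∧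
      gap o b u < r * gap o x u := by
    obtain ⟨Ψ, c, hΨT, hΨu⟩ := geometric_hahn_banach_closed_point hconv hT.isClosed huT
    obtain ⟨m, hm0, hm⟩ := h.exists_gap_lower_bound b.2
    obtain ⟨R, hR⟩ := (h.isCompact_polarAt.image (Ψ.continuous.sub continuous_const :
      Continuous fun u => Ψ u - c)).isBounded.exists_norm_le
    set τ := m / (|R| + 1) with hτ
    have hτ0 : 0 < τ := by positivity
    have heq : ∀ v : StrongDual ℝ E, (1 - τ * c) -
        (ContinuousLinearMap.apply ℝ ℝ ((b : E) - o) - τ • Ψ) v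
        = gap o b v + τ * (Ψ v - c) := by
      intro v
      simp only [gap, sub_apply, smul_apply, smul_eq_mul, ContinuousLinearMap.apply_apply]
      ring
    obtain ⟨r, hr, x, hx, hrx⟩ := h.exists_mul_gap_eq
      (ContinuousLinearMap.apply ℝ ℝ ((b : E) - o) - τ • Ψ) (c := 1 - τ * c) fun v hv => by
        rw [heq]
        have h1 := hR _ (mem_image_of_mem _ hv)
        rw [Real.norm_eq_abs, abs_le] at h1
        have h4 : -R ≤ Ψ v - c := h1.1
        have h5 : τ * -R ≤ τ * (Ψ v - c) := by gcongr
        have h6 : τ * R ≤ τ * |R| := by gcongr; exact le_abs_self R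
        have h2 : τ * (|R| + 1) = m := by rw [hτ]; field_simp
        have h3 := hm v hv
        linarith
    refine ⟨r, hr, x, hx, fun w hw => ?_, ?_⟩
    · rw [← hrx, heq]
      nlinarith [hΨT w hw]
    · rw [← hrx, heq]
      nlinarith
  have hxfunk : funk o T x b ≤ -Real.log r := by
    simpa using h.funk_le_sub_log hT hne hTK (hpos ⟨x, hx⟩) b.2 hr (c := 0)
      (by simpa using hxT)
  have key : ∀ ε > 0, α * (r * gap o x u) + β * (Real.exp ε * gap o b v)
      ≤ Real.exp ε * (Real.exp ε * gap o b (α • u + β • v)) := by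
    intro ε hε
    obtain ⟨z, hz₁, hz₂⟩ := (((hFunk ⟨x, hx⟩).eventually
      (gt_mem_nhds (lt_add_of_pos_right _ hε))).and (hA.eventually (gt_mem_nhds hε))).exists
    have h1 : r * gap o x u ≤ Real.exp ε * scaledGap D o b z u := by
      have h2 := (h.funk_le_iff h.isCompact_polarAt ⟨0, zero_mem_polarAt D o⟩ Subset.rfl
        (exists_gap_pos_polarAt D o x) z.2 (c := ε + funk o K b z - Real.log r)).1
        (by simp only at hz₁; linarith) u hu
      rw [Real.exp_sub, Real.exp_log hr, div_mul_eq_mul_div, le_div_iff₀ hr, Real.exp_add] at h2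
      unfold scaledGap
      linarith
    have h3 := h.gap_le_scaledGap b z hv
    have h4 : scaledGap D o b z (α • u + β • v) ≤ Real.exp ε * gap o b (α • u + β • v) := by
      have h5 := h.gap_le_exp_funk_mul hT hne hTK (hpos z) b.2 hw
      unfold scaledGap
      calc Real.exp (funk o K b z) * gap o z (α • u + β • v)
          ≤ Real.exp (funk o K b z) * (Real.exp (funk o T z b) * gap o b (α • u + β • v)) := by
            gcongr
        _ = Real.exp (funk o K b z + funk o T z b) * gap o b (α • u + β • v) := by
            rw [Real.exp_add, mul_assoc]
        _ ≤ _ := by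
            gcongr
            exact (h.gap_pos b.2 (hTK hw)).le
    calc α * (r * gap o x u) + β * (Real.exp ε * gap o b v)
        ≤ α * (Real.exp ε * scaledGap D o b z u) + β * (Real.exp ε * scaledGap D o b z v) := by
          gcongr
      _ = Real.exp ε * scaledGap D o b z (α • u + β • v) := by
          rw [scaledGap_comb b z hαβ]; ring
      _ ≤ _ := by gcongr
  have hl : ∀ᶠ ε : ℝ in 𝓝[>] 0, α * (r * gap o x u) + β * (Real.exp ε * gap o b v)
      ≤ Real.exp ε * (Real.exp ε * gap o b (α • u + β • v)) :=
    eventually_mem_nhdsWithin.mono key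
  have hc₁ : Continuous fun ε : ℝ => α * (r * gap o x u) + β * (Real.exp ε * gap o b v) := by
    fun_prop
  have hc₂ : Continuous fun ε : ℝ => Real.exp ε * (Real.exp ε * gap o b (α • u + β • v)) := by
    fun_prop
  have hfin := le_of_tendsto_of_tendsto ((hc₁.tendsto 0).mono_left nhdsWithin_le_nhds)
    ((hc₂.tendsto 0).mono_left nhdsWithin_le_nhds) hl
  rw [Real.exp_zero, one_mul, one_mul, one_mul, gap_comb hαβ] at hfin
  have := mul_lt_mul_of_pos_left hxu hα
  linarith

/-- If all horofunctions are Busemann points, then a limit of faces of the polar is a face. -/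
theorem mem_extremeSets_of_pkTendsto (h : IsBoundedConvexDomain D o)
    (hBus : ∀ f ∈ horofunctions (hilbertDist D) b, IsBusemannPoint (hilbertDist D) b f)
    {C : ℕ → Closeds (StrongDual ℝ E)} {L : Closeds (StrongDual ℝ E)}
    (hC : ∀ n, C n ∈ extremeSets (polarAt D o)) (hCL : PKTendsto C L) :
    L ∈ extremeSets (polarAt D o) := by
  set K := polarAt D o with hK
  have hCK : ∀ n, (C n : Set (StrongDual ℝ E)) ⊆ K := fun n => (hC n).2.subset
  have hLK : (L : Set (StrongDual ℝ E)) ⊆ K := fun u hu =>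
    (isClosed_polarAt D o).closure_subset (Metric.mem_closure_iff.2 fun ε hε => by
      obtain ⟨n, v, hv, hd⟩ := (hCL.eventually_exists_dist_lt hu hε).exists
      exact ⟨v, hCK n hv, by rwa [dist_comm]⟩)
  have hLconv : Convex ℝ (L : Set (StrongDual ℝ E)) := by
    intro u hu v hv s t hs ht hst
    refine hCL.mem_of_frequently fun ε hε => Eventually.frequently ?_
    filter_upwards [hCL.eventually_exists_dist_lt hu hε, hCL.eventually_exists_dist_lt hv hε]
      with n ⟨u', hu', hdu⟩ ⟨v', hv', hdv⟩
    refine ⟨s • u' + t • v', (hC n).1 hu' hv' hs ht hst, ?_⟩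
    rw [dist_eq_norm] at *
    have := (convex_ball (0 : StrongDual ℝ E) ε) (mem_ball_zero_iff.2 hdu)
      (mem_ball_zero_iff.2 hdv) hs ht hst
    rw [mem_ball_zero_iff] at this
    convert! this using 2
    module
  refine ⟨hLconv, ?_⟩
  rcases (L : Set (StrongDual ℝ E)).eq_empty_or_nonempty with hemp | hne
  · rw [hemp]
    exact ⟨empty_subset _, fun _ _ _ _ _ hz => absurd hz (notMem_empty _)⟩
  have hLc : IsCompact (L : Set (StrongDual ℝ E)) :=
    h.isCompact_polarAt.of_isClosed_subset L.isClosed hLK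
  have hpos : ∀ x : D, ∃ u ∈ (L : Set (StrongDual ℝ E)), 0 < gap o x u := fun x =>
    h.exists_gap_pos hne hLK x.2
  -- points of the domain whose Funk parts follow the faces
  have : ProperSpace E := FiniteDimensional.proper ℝ E
  have : Nonempty D := ⟨b⟩
  let e := denseSeq D
  have hz : ∀ n : ℕ, ∃ z : D, (C n : Set (StrongDual ℝ E)).Nonempty → ∀ j ≤ n,
      |funk o K (e j) z - funk o K b z - funk o (C n) (e j) b|
        ≤ -Real.log (1 - 1 / ((n : ℝ) + 2)) := by
    intro n
    by_cases hn : (C n : Set (StrongDual ℝ E)).Nonempty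
    · classical
      obtain ⟨z, hz⟩ := h.exists_abs_funk_sub_le b (hC n) hn ((Finset.range (n + 1)).image e)
        (η := 1 / ((n : ℝ) + 2)) (by positivity)
        (by rw [div_lt_one (by positivity)]; linarith [n.cast_nonneg (α := ℝ)])
      exact ⟨z, fun _ j hj => hz _ (Finset.mem_image_of_mem _ (Finset.mem_range.2 (by omega)))⟩
    · exact ⟨b, fun hn' => absurd hn' hn⟩
  choose z hz using hz
  have hzlim : ∀ j, Tendsto (fun n => funk o K (e j) (z n) - funk o K b (z n)) atTop
      (𝓝 (funk o L (e j) b)) := by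
    intro j
    have hlog : Tendsto (fun n : ℕ => -Real.log (1 - 1 / ((n : ℝ) + 2))) atTop (𝓝 0) := by
      have h1 : Tendsto (fun k : ℕ => 1 / ((k : ℝ) + 2)) atTop (𝓝 0) :=
        tendsto_const_nhds.div_atTop (tendsto_natCast_atTop_atTop.atTop_add tendsto_const_nhds)
      have h2 := ((h1.const_sub 1).log (by norm_num)).neg
      simpa using h2
    have hdiff : Tendsto (fun n => funk o K (e j) (z n) - funk o K b (z n)
        - funk o (C n) (e j) b) atTop (𝓝 0) := by
      refine squeeze_zero_norm' ?_ hlog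
      obtain ⟨u, hu⟩ := hne
      filter_upwards [hCL.eventually_exists_dist_lt hu one_pos, eventually_ge_atTop j]
        with n ⟨v, hv, _⟩ hj
      exact hz n ⟨v, hv⟩ j hj
    simpa using hdiff.add (h.tendsto_funk_of_pkTendsto hCL hCK hLK hne (e j) b)
  let U : Ultrafilter ℕ := Ultrafilter.of atTop
  have hU : (U : Filter ℕ) ≤ atTop := Ultrafilter.of_le _
  obtain ⟨ξ, -, hξ⟩ := h.isCompact_closure.exists_tendsto_ultrafilter U
    (v := fun n => (z n : E)) fun n => subset_closure (z n).2
  let f : D → ℝ := fun x => funk o L x b + (funk o K ξ x - funk o K ξ b)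
  have hflip : ∀ x y : D, |f x - f y| ≤ hilbertDist D x y := by
    have h1 : ∀ x y : D, f x - f y ≤ hilbertDist D x y := fun x y => by
      have h2 := h.funk_triangle hLc hne hLK (hpos x) y.2 b.2
      have h3 := h.funk_triangle' ξ y.2 x.2
      rw [h.hilbertDist_eq]
      simp only [f]
      linarith
    intro x y
    rw [abs_le]
    have h2 := h1 y x
    rw [h.hilbertDist_comm] at h2
    exact ⟨by linarith, h1 x y⟩
  have hflim : Tendsto (fun n => asUniformOnBounded (hilbertDist D)
      (distFun (hilbertDist D) b (z n))) U (𝓝 (asUniformOnBounded (hilbertDist D) f)) := by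
    refine h.tendsto_asUniformOnBounded (fun n => h.abs_distFun_sub_le b (z n)) hflip
      (denseRange_denseSeq D) ?_
    rintro _ ⟨j, rfl⟩
    exact (h.tendsto_distFun_iff hξ (e j) _).2 ((hzlim j).mono_left hU)
  -- whether or not `f` is one of the functions `ψ_y`, it is approached in the way required
  obtain ⟨l, hl, hlf, hl0⟩ : ∃ l : Filter D, l.NeBot ∧
      (∀ x, Tendsto (fun y => distFun (hilbertDist D) b y x) l (𝓝 (f x))) ∧
      Tendsto (fun y => hilbertDist D b y + f y) l (𝓝 0) := by
    by_cases hr : f ∈ range (distFun (hilbertDist D) b)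
    · obtain ⟨y, hy⟩ := hr
      refine ⟨pure y, inferInstance, fun x => ?_, ?_⟩
      · rw [← hy]; exact tendsto_pure_nhds _ _
      · have h1 : hilbertDist D b y + f y = 0 := by
          rw [← hy, distFun, hilbertDist_self]; ring
        rw [← h1]; exact tendsto_pure_nhds (fun y => hilbertDist D b y + f y) y
    · have hcont : SymContinuous (hilbertDist D) f := by
        intro x ε hε
        refine ⟨ε, hε, fun y hy => ?_⟩
        unfold symDist at hy
        have h1 := hflip y x
        have h2 : 0 ≤ hilbertDist D x y := (abs_nonneg _).trans (hflip x y)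
        linarith
      obtain ⟨-, T, γ, hγ, hγf⟩ := hBus f ⟨hcont, mem_closure_of_tendsto hflim
        (Eventually.of_forall fun n => mem_range_self _), hr⟩
      have hpt := asUniformOnBounded_apply_tendsto hilbertDist_self hγf
      have : Nonempty T := ⟨⟨0, hγ.2.2.1⟩⟩
      exact ⟨map γ atTop, inferInstance, fun x => tendsto_map'_iff.2 (hpt x),
        tendsto_map'_iff.2 (hγ.tendsto_dist_add hilbertDist_self hpt)⟩
  exact h.isExtreme_of_tendsto hLc hLconv hne hLK ξ hlf hl0

end IsBoundedConvexDomain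

theorem mainTheorem4 {E : Type*} [NormedAddCommGroup E] [NormedSpace ℝ E] [FiniteDimensional ℝ E]
    (D : Set E) (hbounded : Bornology.IsBounded D) (hopen : IsOpen D) (hconvex : Convex ℝ D)
    (b : D) (o : E) (ho : o ∈ D) :
    (∀ f ∈ horofunctions (hilbertDist D) b, IsBusemannPoint (hilbertDist D) b f) ↔
      IsClosed[painleveKuratowskiTopology (StrongDual ℝ E)] (extremeSets (polarAt D o)) := by
  have h : IsBoundedConvexDomain D o := ⟨hbounded, hopen, hconvex, ho⟩
  rw [isClosed_painleveKuratowski_iff]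
  exact ⟨fun hBus C L hC hCL => h.mem_extremeSets_of_pkTendsto hBus hC hCL,
    fun hlim f hf => h.isBusemannPoint_of_mem_horofunctions hlim hf⟩
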